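/- Let $K$ be a number field with algebraic closure $\overline K$ and let $p=[A,B,C,D,E]\in\mathbb P^4(K)$. Let $X_p\subset\mathbb P^3$ be the quartic surface $$A(x^4+y^4+z^4+w^4)+Bxyzw+C(x^2y^2+z^2w^2)+D(x^2z^2+y^2w^2)+E(x^2w^2+y^2z^2)=0,$$ and put $\Delta=16A^3+AB^2-4A(C^2+D^2+E^2)+4CDE$, $q_{\pm C}=2A\pm C$, $q_{\pm D}=2A\pm D$, $q_{\pm E}=2A\pm E$, $$\begin{aligned} p_{\pm0}&=4A\pm B+2C+2D+2E, & p_{\pm1}&=4A\pm B+2C-2D-2E,\\ p_{\pm2}&=4A\pm B-2C+2D-2E, & p_{\pm3}&=4A\pm B-2C-2D+2E. \end{aligned}$$ The Segre cubic is $\{\Delta=0\}\subset\mathbb P^4$; the singular hyperplanes are the $15$ hyperplanes $A=0$, $q_{\pm C}=0$, $q_{\pm D}=0$, $q_{\pm E}=0$, $p_{\pm 0}=0,\dots,p_{\pm3}=0$. Let $q_1=[1,0,-2,-2,2]$, a node of the Segre cubic, with $X_{q_1}=\{Q_1^2=0\}$, $Q_1=x^2-y^2-z^2+w^2$, and let $$\beta=48A^2+B^2+16A(C+D-E)-4(C^2+D^2+E^2)+8(CD-CE-DE).$$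 Assume that $p$ lies neither on the Segre cubic nor on a singular hyperplane, and that the third point of intersection $p_1$ of the Segre cubic with the line through $p$ and $q_1$ is different from $q_1$; equivalently $\beta\neq0$. Write $p_1=[A_1,B_1,C_1,D_1,E_1]$ with homogeneous coordinates normalised by $\beta p=\Delta q_1+p_1$ (as vectors), so that $\beta X_p=\Delta Q_1^2+X_{p_1}$ as equations. For a singular point $n=[n_0:n_1:n_2:n_3]$ of $X_{p_1}$ over $\overline K$ let $T=n_0x+n_1y+n_2z+n_3w$ be the dual plane; then $X_{p_1}=\mu Q'^2+\lambda T$ for a constant $\mu$, a quadratic form $Q'$ and a cubic form $\lambda$. The conics associated to $q_1$ are the subschemes $\{T=0,\ Q_1\pm\sqrt{-\mu/\Delta}\,Q'=0\}$ of $\mathbb P^3_{\overline K}$, for all such $n$. Then: 1. There are exactly $32$ conics associated to $q_1$, and they lie on $X_p$. 2. The smallest intermediate field of $\overline K/K$ over which all these $32$ conics are defined is $$M=K\left(\sqrt{\Delta q_{+C}p_{-0}p_{+1}},\sqrt{\Delta q_{+C}p_{+0}p_{-1}},\sqrt{\Delta q_{+D}p_{+0}p_{-2}},\sqrt{\Delta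 q_{+D}p_{-0}p_{+2}},\sqrt{-\Delta q_{-E}p_{+1}p_{-2}}\right).$$ 3. Let $[r_3:r_2:r_1:1]$ be a singular point of $X_{p_1}$ over $\overline K$ with $r_1r_2r_3\neq0$ (such a point exists if $B\ne0$), put $\overline r_1=r_2/r_3$, let $r_\mu$ be a root of $x^2+\frac1\Delta(A_1r_1^4+C_1r_1^2+A_1)$ and $\overline r_\mu$ a root of $x^2+\frac1\Delta(A_1\overline r_1^4+C_1\overline r_1^2+A_1)$, and let $K_1=K(r_1,r_2,r_\mu,\overline r_\mu)$. Then the $32$ conics are defined over $K_1$, and $K_1=M$ inside $\overline K$ (in particular $K_1\cong M$ over $K$). -/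

import Mathlib

namespace HeisenbergQuartic

open MvPolynomial

section Parameters

variable {R : Type*} [CommRing R]

/- A parameter `p = [A, B, C, D, E]` is given by homogeneous coordinates `p : Fin 5 → R`,
   with `A = p 0`, `B = p 1`, `C = p 2`, `D = p 3`, `E = p 4`. -/

/-- The cubic form `Δ = 16A³ + AB² - 4A(C² + D² + E²) + 4CDE` defining the Segre cubic. -/
def segre (p : Fin 5 → R) : R :=
  16 * p 0 ^ 3 + p 0 * p 1 ^ 2 - 4 * p 0 * (p 2 ^ 2 + p 3 ^ 2 + p 4 ^ 2) + 4 * p 2 * p 3 * p 4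

/-- `q_{+C}` -/
def qPlusC (p : Fin 5 → R) : R := 2 * p 0 + p 2
/-- `q_{-C}` -/
def qMinusC (p : Fin 5 → R) : R := 2 * p 0 - p 2
/-- `q_{+D}` -/
def qPlusD (p : Fin 5 → R) : R := 2 * p 0 + p 3
/-- `q_{-D}` -/
def qMinusD (p : Fin 5 → R) : R := 2 * p 0 - p 3
/-- `q_{+E}` -/
def qPlusE (p : Fin 5 → R) : R := 2 * p 0 + p 4
/-- `q_{-E}` -/
def qMinusE (p : Fin 5 → R) : R := 2 * p 0 - p 4
/-- `p_{+0}` -/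
def pPlus0 (p : Fin 5 → R) : R := 4 * p 0 + p 1 + 2 * p 2 + 2 * p 3 + 2 * p 4
/-- `p_{+1}` -/
def pPlus1 (p : Fin 5 → R) : R := 4 * p 0 + p 1 + 2 * p 2 - 2 * p 3 - 2 * p 4
/-- `p_{+2}` -/
def pPlus2 (p : Fin 5 → R) : R := 4 * p 0 + p 1 - 2 * p 2 + 2 * p 3 - 2 * p 4
/-- `p_{+3}` -/
def pPlus3 (p : Fin 5 → R) : R := 4 * p 0 + p 1 - 2 * p 2 - 2 * p 3 + 2 * p 4
/-- `p_{-0}` -/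
def pMinus0 (p : Fin 5 → R) : R := 4 * p 0 - p 1 + 2 * p 2 + 2 * p 3 + 2 * p 4
/-- `p_{-1}` -/
def pMinus1 (p : Fin 5 → R) : R := 4 * p 0 - p 1 + 2 * p 2 - 2 * p 3 - 2 * p 4
/-- `p_{-2}` -/
def pMinus2 (p : Fin 5 → R) : R := 4 * p 0 - p 1 - 2 * p 2 + 2 * p 3 - 2 * p 4
/-- `p_{-3}` -/
def pMinus3 (p : Fin 5 → R) : R := 4 * p 0 - p 1 - 2 * p 2 - 2 * p 3 + 2 * p 4

/-- `p` lies on none of the fifteen singular hyperplanes. -/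
def OffSingularHyperplanes (p : Fin 5 → R) : Prop :=
  p 0 ≠ 0 ∧
  qPlusC p ≠ 0 ∧ qMinusC p ≠ 0 ∧ qPlusD p ≠ 0 ∧ qMinusD p ≠ 0 ∧ qPlusE p ≠ 0 ∧ qMinusE p ≠ 0 ∧
  pPlus0 p ≠ 0 ∧ pPlus1 p ≠ 0 ∧ pPlus2 p ≠ 0 ∧ pPlus3 p ≠ 0 ∧
  pMinus0 p ≠ 0 ∧ pMinus1 p ≠ 0 ∧ pMinus2 p ≠ 0 ∧ pMinus3 p ≠ 0

/-- The node `q₁ = [1, 0, -2, -2, 2]` of the Segre cubic. -/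
def node1 (R : Type*) [CommRing R] : Fin 5 → R := ![1, 0, -2, -2, 2]

/-- The polar `(q₁ · ∇Δ)(p)`, a quadratic form whose zeros are the points `p` for which
the line through `p` and `q₁` lies in the tangent cone of the Segre cubic at `q₁`. -/
def beta (p : Fin 5 → R) : R :=
  48 * p 0 ^ 2 + p 1 ^ 2 + 16 * p 0 * (p 2 + p 3 - p 4) - 4 * (p 2 ^ 2 + p 3 ^ 2 + p 4 ^ 2)
    + 8 * (p 2 * p 3 - p 2 * p 4 - p 3 * p 4)

/-- The third point of intersection `p₁` of the Segre cubic with the line through `p` and the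
node `q₁`, in the homogeneous coordinates for which `β p = Δ q₁ + p₁`
(see `segre_line` and `thirdPoint_unique`). -/
def thirdPoint (p : Fin 5 → R) : Fin 5 → R := beta p • p - segre p • node1 R

/-- On the line through `p` and `q₁` the Segre cubic cuts out `q₁` twice and the point with
parameters `(s : t) = (β : -Δ)`. -/
theorem segre_line (p : Fin 5 → R) (s t : R) :
    segre (s • p + t • node1 R) = s ^ 2 * (s * segre p + t * beta p) := by
  simp [segre, beta, node1]
  ring

theorem segre_thirdPoint (p : Fin 5 → R) : segre (thirdPoint p) = 0 := by
  have h := segre_line p (beta p) (-segre p)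
  rw [neg_smul, ← sub_eq_add_neg] at h
  rw [thirdPoint, h]
  ring

theorem thirdPoint_unique [IsDomain R] (p : Fin 5 → R) (s t : R) (hs : s ≠ 0)
    (h : segre (s • p + t • node1 R) = 0) :
    beta p • (s • p + t • node1 R) = s • thirdPoint p := by
  rw [segre_line] at h
  have h' : t * beta p = -(s * segre p) := by
    have := (mul_eq_zero.mp h).resolve_left (pow_ne_zero 2 hs)
    linear_combination this
  ext i
  simp only [thirdPoint, Pi.smul_apply, Pi.add_apply, Pi.sub_apply, smul_eq_mul]
  linear_combination (node1 R i) * h'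

end Parameters

section Surfaces

variable {R : Type*} [CommRing R]

/-- The form defining the surface `X_p`, with `x = X 0`, `y = X 1`, `z = X 2`, `w = X 3`. -/
noncomputable def quartic (p : Fin 5 → R) : MvPolynomial (Fin 4) R :=
  C (p 0) * (X 0 ^ 4 + X 1 ^ 4 + X 2 ^ 4 + X 3 ^ 4)
    + C (p 1) * (X 0 * X 1 * X 2 * X 3)
    + C (p 2) * (X 0 ^ 2 * X 1 ^ 2 + X 2 ^ 2 * X 3 ^ 2)
    + C (p 3) * (X 0 ^ 2 * X 2 ^ 2 + X 1 ^ 2 * X 3 ^ 2)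
    + C (p 4) * (X 0 ^ 2 * X 3 ^ 2 + X 1 ^ 2 * X 2 ^ 2)

/-- The quadratic form `Q₁`, whose square defines `X_{q₁}`. -/
noncomputable def quadric1 (R : Type*) [CommRing R] : MvPolynomial (Fin 4) R :=
  X 0 ^ 2 - X 1 ^ 2 - X 2 ^ 2 + X 3 ^ 2

theorem quartic_node1 : quartic (node1 R) = quadric1 R ^ 2 := by
  simp only [quartic, node1, quadric1, Matrix.cons_val, map_one, map_zero, map_neg, map_ofNat]
  ring

/-- `β X_p = Δ Q₁² + X_{p₁}`. -/
theorem quartic_pencil (p : Fin 5 → R) :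
    C (beta p) * quartic p = C (segre p) * quadric1 R ^ 2 + quartic (thirdPoint p) := by
  rw [← quartic_node1]
  simp only [quartic, thirdPoint, Pi.sub_apply, Pi.smul_apply, smul_eq_mul, map_sub, map_mul]
  ring

/-- `n` represents a singular point of the surface `X_p`. -/
def IsSingularPoint (p : Fin 5 → R) (n : Fin 4 → R) : Prop :=
  n ≠ 0 ∧ eval n (quartic p) = 0 ∧ ∀ i, eval n (pderiv i (quartic p)) = 0

/-- The linear form defining the plane dual to the point `n`. -/
noncomputable def dualPlane (n : Fin 4 → R) : MvPolynomial (Fin 4) R := ∑ i, C (n i) * X i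

/-- The conics of `X_p` associated with the node `q₁`, as closed subschemes of projective
3-space, i.e. as ideals `(T, Q₁ + √(-μ/Δ) Q')`. Here `T` is the plane dual to a singular point `n`
of the Kummer surface `X_{p₁}`, which touches that surface along a conic:
`X_{p₁} = μ Q'² + λ T` with a quadratic form `Q'`. Both square roots are allowed. -/
def associatedConics {L : Type*} [Field L] (p : Fin 5 → L) :
    Set (Ideal (MvPolynomial (Fin 4) L)) :=
  {I | ∃ (n : Fin 4 → L) (Q' l : MvPolynomial (Fin 4) L) (μ ρ : L),
    IsSingularPoint (thirdPoint p) n ∧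
    Q'.IsHomogeneous 2 ∧
    quartic (thirdPoint p) = C μ * Q' ^ 2 + l * dualPlane n ∧
    ρ ^ 2 = -μ / segre p ∧
    I = Ideal.span {dualPlane n, quadric1 L + C ρ * Q'}}

end Surfaces

/-- The closed subscheme of projective 3-space over `L` with ideal `I` is defined over the
intermediate field `F`: the ideal is generated by polynomials with coefficients in `F`. -/
def IsDefinedOver {K L : Type*} [Field K] [Field L] [Algebra K L] (F : IntermediateField K L)
    (I : Ideal (MvPolynomial (Fin 4) L)) : Prop :=
  ∃ S : Set (MvPolynomial (Fin 4) F), I = Ideal.span (MvPolynomial.map (algebraMap F L) '' S)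

/-- The coordinates `p`, seen in the extension field `L`. -/
def coordsIn {K : Type*} [Field K] (L : Type*) [Field L] [Algebra K L] (p : Fin 5 → K) :
    Fin 5 → L := fun i => algebraMap K L (p i)

/-- The field obtained from `K` by adjoining the square roots of
`Δ q_{+C} p_{-0} p_{+1}`, `Δ q_{+C} p_{+0} p_{-1}`, `Δ q_{+D} p_{+0} p_{-2}`,
`Δ q_{+D} p_{-0} p_{+2}` and `-Δ q_{-E} p_{+1} p_{-2}` in `L`. -/
def sqrtField {K : Type*} [Field K] (L : Type*) [Field L] [Algebra K L] (p : Fin 5 → K) :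
    IntermediateField K L :=
  IntermediateField.adjoin K
    {x : L |
      x ^ 2 = algebraMap K L (segre p * qPlusC p * pMinus0 p * pPlus1 p) ∨
      x ^ 2 = algebraMap K L (segre p * qPlusC p * pPlus0 p * pMinus1 p) ∨
      x ^ 2 = algebraMap K L (segre p * qPlusD p * pPlus0 p * pMinus2 p) ∨
      x ^ 2 = algebraMap K L (segre p * qPlusD p * pMinus0 p * pPlus2 p) ∨
      x ^ 2 = algebraMap K L (-segre p * qMinusE p * pPlus1 p * pMinus2 p)}

/-- `F` is a field `K₁ = K(r₁, r₂, r_μ, r̄_μ)`: here `[r₃ : r₂ : r₁ : 1]` is a singular point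
of `X_{p₁}` with nonzero coordinates, `p₁ = [A₁, B₁, C₁, D₁, E₁]`, and, with `r̄₁ = r₂ / r₃`,
`r_μ` is a root of `x² + (A₁ r₁⁴ + C₁ r₁² + A₁) / Δ` and
`r̄_μ` is a root of `x² + (A₁ r̄₁⁴ + C₁ r̄₁² + A₁) / Δ`. -/
def IsK1 {K L : Type*} [Field K] [Field L] [Algebra K L] (p : Fin 5 → K)
    (F : IntermediateField K L) : Prop :=
  ∃ r₁ r₂ r₃ rμ rμ' : L,
    r₁ ≠ 0 ∧ r₂ ≠ 0 ∧ r₃ ≠ 0 ∧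
    IsSingularPoint (thirdPoint (coordsIn L p)) ![r₃, r₂, r₁, 1] ∧
    rμ ^ 2 + 1 / segre (coordsIn L p) *
      (thirdPoint (coordsIn L p) 0 * r₁ ^ 4 + thirdPoint (coordsIn L p) 2 * r₁ ^ 2
        + thirdPoint (coordsIn L p) 0) = 0 ∧
    rμ' ^ 2 + 1 / segre (coordsIn L p) *
      (thirdPoint (coordsIn L p) 0 * (r₂ / r₃) ^ 4 + thirdPoint (coordsIn L p) 2 * (r₂ / r₃) ^ 2
        + thirdPoint (coordsIn L p) 0) = 0 ∧
    F = IntermediateField.adjoin K {r₁, r₂, rμ, rμ'}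

end HeisenbergQuartic

open HeisenbergQuartic

/-! A Heisenberg invariant quartic on the Segre cubic, away from the singular hyperplanes, is a
Kummer surface. Any node `n` recovers it: its parameters are a multiple `t` of the polynomials
`kummer n` (`IsSingularPoint.exists_eq_smul_kummer`). The nodes form a single orbit of sixteen
points under the Heisenberg group (`IsSingularPoint.exists_heis`), and on the plane dual to `n` the
quartic is `-t/4` times the square of the diagonal form `Q' = tropeQuadric n` (`quartic_kummer`). On
that plane `β X_p` is therefore `Δ Q₁² - (t/4) Q'²`, which splits into the two conics `Q₁ ± ρ Q'`
with `4Δρ² = t`. Sixteen planes with two conics each give 32.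

By Galois descent such a conic is defined over `F` exactly when `ρ` and the coordinates of the node,
scaled so that one of them is `1`, lie in `F`. To compare with `M`, pull the singular hyperplanes
back along `kummer`: they become products of fundamental quadrics, and each radicand becomes `Δ t`
times the square of such a product (`radicands_eq`). So `M` is generated by `2Δρ` times five
products of fundamental quadrics, and lies in any field containing the node and `ρ`. Conversely
`mul_mem_sqrtField` recovers the node from these five numbers, and then `ρ` follows. The field `K₁`
contains the same data, because `r_μ` and `r̄_μ` are `±ρ` times values of `Q'`. -/

namespace HeisenbergQuartic

open MvPolynomial

/-! ### Kummer surfaces parametrised by a node. -/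

section FundamentalQuadrics

variable {R : Type*} [CommRing R]

/-! The ten fundamental quadrics of the Heisenberg group. -/

/-- The fundamental quadric `a² + b² + c² + d²`. -/
def s0 (n : Fin 4 → R) : R := n 0 ^ 2 + n 1 ^ 2 + n 2 ^ 2 + n 3 ^ 2
/-- The fundamental quadric `a² + b² - c² - d²`. -/
def sC (n : Fin 4 → R) : R := n 0 ^ 2 + n 1 ^ 2 - n 2 ^ 2 - n 3 ^ 2
/-- The fundamental quadric `a² - b² + c² - d²`. -/
def sD (n : Fin 4 → R) : R := n 0 ^ 2 - n 1 ^ 2 + n 2 ^ 2 - n 3 ^ 2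
/-- The fundamental quadric `a² - b² - c² + d²`. -/
def sE (n : Fin 4 → R) : R := n 0 ^ 2 - n 1 ^ 2 - n 2 ^ 2 + n 3 ^ 2
/-- The fundamental quadric `ab + cd`. -/
def uC (n : Fin 4 → R) : R := n 0 * n 1 + n 2 * n 3
/-- The fundamental quadric `ab - cd`. -/
def vC (n : Fin 4 → R) : R := n 0 * n 1 - n 2 * n 3
/-- The fundamental quadric `ac + bd`. -/
def uD (n : Fin 4 → R) : R := n 0 * n 2 + n 1 * n 3
/-- The fundamental quadric `ac - bd`. -/
def vD (n : Fin 4 → R) : R := n 0 * n 2 - n 1 * n 3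
/-- The fundamental quadric `ad + bc`. -/
def uE (n : Fin 4 → R) : R := n 0 * n 3 + n 1 * n 2
/-- The fundamental quadric `ad - bc`. -/
def vE (n : Fin 4 → R) : R := n 0 * n 3 - n 1 * n 2

/-- The point `n` lies on none of the ten fundamental quadrics. -/
structure OffFundamentalQuadrics (n : Fin 4 → R) : Prop where
  s0 : s0 n ≠ 0
  sC : sC n ≠ 0
  sD : sD n ≠ 0
  sE : sE n ≠ 0
  uC : uC n ≠ 0
  vC : vC n ≠ 0
  uD : uD n ≠ 0
  vD : vD n ≠ 0
  uE : uE n ≠ 0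
  vE : vE n ≠ 0

/-- The parameters of the Heisenberg invariant Kummer surface with node `n`. -/
def kummer (n : Fin 4 → R) : Fin 5 → R :=
  ![uC n * vC n * (uD n * vD n) * (uE n * vE n),
    2 * (n 0 * n 1 * n 2 * n 3) * (s0 n * sC n * sD n * sE n),
    (n 2 ^ 4 + n 3 ^ 4 - n 0 ^ 4 - n 1 ^ 4) * (uD n * vD n) * (uE n * vE n),
    (n 1 ^ 4 + n 3 ^ 4 - n 0 ^ 4 - n 2 ^ 4) * (uC n * vC n) * (uE n * vE n),
    (n 1 ^ 4 + n 2 ^ 4 - n 0 ^ 4 - n 3 ^ 4) * (uC n * vC n) * (uD n * vD n)]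

/-- The coefficients of the diagonal quadric through the six nodes on the plane dual to `n`. -/
def tropeCoeff (n : Fin 4 → R) : Fin 4 → R :=
  ![n 0 ^ 6 - n 0 ^ 2 * (n 1 ^ 4 + n 2 ^ 4 + n 3 ^ 4) + 2 * n 1 ^ 2 * n 2 ^ 2 * n 3 ^ 2,
    n 1 ^ 6 - n 1 ^ 2 * (n 0 ^ 4 + n 2 ^ 4 + n 3 ^ 4) + 2 * n 0 ^ 2 * n 2 ^ 2 * n 3 ^ 2,
    n 2 ^ 6 - n 2 ^ 2 * (n 0 ^ 4 + n 1 ^ 4 + n 3 ^ 4) + 2 * n 0 ^ 2 * n 1 ^ 2 * n 3 ^ 2,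
    n 3 ^ 6 - n 3 ^ 2 * (n 0 ^ 4 + n 1 ^ 4 + n 2 ^ 4) + 2 * n 0 ^ 2 * n 1 ^ 2 * n 2 ^ 2]

/-- The diagonal quadratic form with coefficients `c`. -/
noncomputable def diagQuadric (c : Fin 4 → R) : MvPolynomial (Fin 4) R :=
  ∑ i, C (c i) * X i ^ 2

/-- The diagonal quadric cutting out the conic along which the plane dual to `n` touches
the Kummer surface with node `n`. -/
noncomputable def tropeQuadric (n : Fin 4 → R) : MvPolynomial (Fin 4) R :=
  diagQuadric (tropeCoeff n)

theorem quartic_smul (t : R) (p : Fin 5 → R) : quartic (t • p) = C t * quartic p := by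
  simp only [quartic, Pi.smul_apply, smul_eq_mul, map_mul]
  ring

theorem quartic_kummer (n : Fin 4 → R) :
    ∃ l, 4 * quartic (kummer n) = - tropeQuadric n ^ 2 + l * dualPlane n := by
  -- In these scaled coordinates the plane is `a + b + c + d = 0`, and the cofactor is a symmetric
  -- cubic times a constant.
  let a : MvPolynomial (Fin 4) R := C (n 0) * X 0
  let b : MvPolynomial (Fin 4) R := C (n 1) * X 1
  let c : MvPolynomial (Fin 4) R := C (n 2) * X 2
  let d : MvPolynomial (Fin 4) R := C (n 3) * X 3
  refine ⟨C (s0 n * sC n * sD n * sE n) *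
    (a ^ 3 + b ^ 3 + c ^ 3 + d ^ 3 - a ^ 2 * (b + c + d) - b ^ 2 * (a + c + d)
      - c ^ 2 * (a + b + d) - d ^ 2 * (a + b + c)
      + 2 * (a * b * c + a * b * d + a * c * d + b * c * d)), ?_⟩
  simp only [quartic, kummer, tropeQuadric, diagQuadric, tropeCoeff, dualPlane, Fin.sum_univ_four,
    a, b, c, d, s0, sC, sD, sE, uC, vC, uD, vD, uE, vE, Matrix.cons_val, map_add, map_sub, map_mul, map_pow,
    map_ofNat]
  ring

theorem segre_smul (t : R) (p : Fin 5 → R) : segre (t • p) = t ^ 3 * segre p := by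
  simp only [segre, Pi.smul_apply, smul_eq_mul]
  ring

theorem segre_kummer (n : Fin 4 → R) : segre (kummer n) = 0 := by
  simp only [segre, kummer, s0, sC, sD, sE, uC, vC, uD, vD, uE, vE, Matrix.cons_val]
  ring

theorem beta_smul (t : R) (p : Fin 5 → R) : beta (t • p) = t ^ 2 * beta p := by
  simp only [beta, Pi.smul_apply, smul_eq_mul]
  ring

theorem beta_kummer (n : Fin 4 → R) :
    beta (kummer n) = 4 * sE n ^ 2 * (s0 n * sC n * sD n * sE n * (uC n * vC n) * (uD n * vD n)
      * (uE n * vE n)) := by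
  simp only [beta, kummer, s0, sC, sD, sE, uC, vC, uD, vD, uE, vE, Matrix.cons_val]
  ring

theorem beta_thirdPoint (p : Fin 5 → R) : beta (thirdPoint p) = beta p ^ 3 := by
  -- `beta` is the tangent cone of the cubic at `q₁`; `q₁` is its vertex, so moving along `q₁` does
  -- not change its value.
  have h (s t : R) : beta (s • p - t • node1 R) = s ^ 2 * beta p := by
    simp only [beta, node1, Pi.sub_apply, Pi.smul_apply, smul_eq_mul, Matrix.cons_val]
    ring
  rw [thirdPoint, h]
  ring

/-- Linear forms of singular hyperplanes split into fundamental quadrics on the family `kummer`.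
These factorisations are what turns the radicands of `M` into squares times one common factor. -/
theorem qPlusC_kummer (n : Fin 4 → R) :
    qPlusC (kummer n) = -(sD n * sE n * (uD n * vD n) * (uE n * vE n)) := by
  simp only [qPlusC, kummer, s0, sC, sD, sE, uC, vC, uD, vD, uE, vE, Matrix.cons_val]
  ring

theorem qPlusD_kummer (n : Fin 4 → R) :
    qPlusD (kummer n) = -(sC n * sE n * (uC n * vC n) * (uE n * vE n)) := by
  simp only [qPlusD, kummer, s0, sC, sD, sE, uC, vC, uD, vD, uE, vE, Matrix.cons_val]
  ring

theorem qMinusC_kummer (n : Fin 4 → R) :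
    qMinusC (kummer n) = s0 n * sC n * (uD n * vD n) * (uE n * vE n) := by
  simp only [qMinusC, kummer, s0, sC, sD, sE, uC, vC, uD, vD, uE, vE, Matrix.cons_val]
  ring

theorem qMinusE_kummer (n : Fin 4 → R) :
    qMinusE (kummer n) = s0 n * sE n * (uC n * vC n) * (uD n * vD n) := by
  simp only [qMinusE, kummer, s0, sC, sD, sE, uC, vC, uD, vD, uE, vE, Matrix.cons_val]
  ring

theorem pPlus0_kummer (n : Fin 4 → R) :
    pPlus0 (kummer n) = 2 * (sC n * sD n * sE n * vC n * vD n * vE n) := by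
  simp only [pPlus0, kummer, s0, sC, sD, sE, uC, vC, uD, vD, uE, vE, Matrix.cons_val]
  ring

theorem pPlus1_kummer (n : Fin 4 → R) :
    pPlus1 (kummer n) = 2 * (s0 n * sD n * sE n * vC n * uD n * uE n) := by
  simp only [pPlus1, kummer, s0, sC, sD, sE, uC, vC, uD, vD, uE, vE, Matrix.cons_val]
  ring

theorem pPlus2_kummer (n : Fin 4 → R) :
    pPlus2 (kummer n) = 2 * (s0 n * sC n * sE n * uC n * vD n * uE n) := by
  simp only [pPlus2, kummer, s0, sC, sD, sE, uC, vC, uD, vD, uE, vE, Matrix.cons_val]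
  ring

theorem pMinus0_kummer (n : Fin 4 → R) :
    pMinus0 (kummer n) = -2 * (sC n * sD n * sE n * uC n * uD n * uE n) := by
  simp only [pMinus0, kummer, s0, sC, sD, sE, uC, vC, uD, vD, uE, vE, Matrix.cons_val]
  ring

theorem pMinus1_kummer (n : Fin 4 → R) :
    pMinus1 (kummer n) = -2 * (s0 n * sD n * sE n * uC n * vD n * vE n) := by
  simp only [pMinus1, kummer, s0, sC, sD, sE, uC, vC, uD, vD, uE, vE, Matrix.cons_val]
  ring

theorem pMinus2_kummer (n : Fin 4 → R) :
    pMinus2 (kummer n) = -2 * (s0 n * sC n * sE n * vC n * uD n * vE n) := by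
  simp only [pMinus2, kummer, s0, sC, sD, sE, uC, vC, uD, vD, uE, vE, Matrix.cons_val]
  ring

/-- The six linear forms used below vanish at the node `q₁`, so they take proportional values at
`p` and at the third point of intersection. -/
theorem hyperplanes_thirdPoint (p : Fin 5 → R) :
    qPlusC (thirdPoint p) = beta p * qPlusC p ∧ qPlusD (thirdPoint p) = beta p * qPlusD p ∧
    qMinusE (thirdPoint p) = beta p * qMinusE p ∧
    pPlus0 (thirdPoint p) = beta p * pPlus0 p ∧ pPlus1 (thirdPoint p) = beta p * pPlus1 p ∧
    pPlus2 (thirdPoint p) = beta p * pPlus2 p ∧ pMinus0 (thirdPoint p) = beta p * pMinus0 p ∧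
    pMinus1 (thirdPoint p) = beta p * pMinus1 p ∧ pMinus2 (thirdPoint p) = beta p * pMinus2 p := by
  simp only [thirdPoint, node1, qPlusC, qPlusD, qMinusE, pPlus0, pPlus1, pPlus2, pMinus0, pMinus1,
    pMinus2, Pi.sub_apply, Pi.smul_apply, smul_eq_mul, Matrix.cons_val]
  refine ⟨?_, ?_, ?_, ?_, ?_, ?_, ?_, ?_, ?_⟩ <;> ring

theorem singularPoint_iff (p : Fin 5 → R) (n : Fin 4 → R) :
    IsSingularPoint p n ↔ n ≠ 0 ∧
      p 0 * (n 0 ^ 4 + n 1 ^ 4 + n 2 ^ 4 + n 3 ^ 4) + p 1 * (n 0 * n 1 * n 2 * n 3)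
        + p 2 * (n 0 ^ 2 * n 1 ^ 2 + n 2 ^ 2 * n 3 ^ 2)
        + p 3 * (n 0 ^ 2 * n 2 ^ 2 + n 1 ^ 2 * n 3 ^ 2)
        + p 4 * (n 0 ^ 2 * n 3 ^ 2 + n 1 ^ 2 * n 2 ^ 2) = 0 ∧
      4 * p 0 * n 0 ^ 3 + p 1 * (n 1 * n 2 * n 3)
        + 2 * n 0 * (p 2 * n 1 ^ 2 + p 3 * n 2 ^ 2 + p 4 * n 3 ^ 2) = 0 ∧
      4 * p 0 * n 1 ^ 3 + p 1 * (n 0 * n 2 * n 3)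
        + 2 * n 1 * (p 2 * n 0 ^ 2 + p 3 * n 3 ^ 2 + p 4 * n 2 ^ 2) = 0 ∧
      4 * p 0 * n 2 ^ 3 + p 1 * (n 0 * n 1 * n 3)
        + 2 * n 2 * (p 2 * n 3 ^ 2 + p 3 * n 0 ^ 2 + p 4 * n 1 ^ 2) = 0 ∧
      4 * p 0 * n 3 ^ 3 + p 1 * (n 0 * n 1 * n 2)
        + 2 * n 3 * (p 2 * n 2 ^ 2 + p 3 * n 1 ^ 2 + p 4 * n 0 ^ 2) = 0 := by
  rw [IsSingularPoint, Fin.forall_fin_succ, Fin.forall_fin_succ, Fin.forall_fin_succ,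
    Fin.forall_fin_one]
  refine and_congr Iff.rfl (and_congr ?_ (and_congr ?_ (and_congr ?_ (and_congr ?_ ?_)))) <;>
  refine Eq.congr ?_ rfl <;>
  simp [quartic, pderiv_X, Derivation.leibniz, Derivation.leibniz_pow] <;>
  ring

theorem singularPoint_kummer {n : Fin 4 → R} (hn : n ≠ 0) (t : R) :
    IsSingularPoint (t • kummer n) n := by
  rw [singularPoint_iff]
  simp only [kummer, s0, sC, sD, sE, uC, vC, uD, vD, uE, vE, Matrix.cons_val, Pi.smul_apply,
    smul_eq_mul]
  refine ⟨hn, ?_, ?_, ?_, ?_, ?_⟩ <;> ring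

end FundamentalQuadrics

/-! ### A node determines its Kummer surface. -/

section Nodes

variable {L : Type*} [Field L]

/-- Three relations that determine the squares of the coordinates of a node. -/
def NodeRelations (q : Fin 5 → L) (n : Fin 4 → L) : Prop :=
  qPlusC q * (s0 n * sC n) + qMinusC q * (sD n * sE n) = 0 ∧
  qPlusD q * (s0 n * sD n) + qMinusD q * (sC n * sE n) = 0 ∧
  qPlusE q * (s0 n * sE n) + qMinusE q * (sC n * sD n) = 0

/-- In `n i * ∂ᵢ` the `B`-term is always `B * n 0 * n 1 * n 2 * n 3`. A signed sum with two plus and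
two minus signs cancels it, and what is left factors through `s0`, `sC`, `sD`, `sE`. -/
theorem IsSingularPoint.nodeRelations {q : Fin 5 → L} {n : Fin 4 → L} (h : IsSingularPoint q n) :
    NodeRelations q n := by
  obtain ⟨-, -, e0, e1, e2, e3⟩ := (singularPoint_iff q n).1 h
  simp only [NodeRelations, qPlusC, qMinusC, qPlusD, qMinusD, qPlusE, qMinusE, s0, sC, sD, sE]
  refine ⟨?_, ?_, ?_⟩
  · linear_combination n 0 * e0 + n 1 * e1 - n 2 * e2 - n 3 * e3
  · linear_combination n 0 * e0 - n 1 * e1 + n 2 * e2 - n 3 * e3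
  · linear_combination n 0 * e0 - n 1 * e1 - n 2 * e2 + n 3 * e3

/-- A point whose coordinates have equal squares up to sign is not a singular point. -/
theorem IsSingularPoint.not_sq_eq {q : Fin 5 → L} {n : Fin 4 → L} (h : IsSingularPoint q n)
    {t s : L} (ht : t ^ 2 = 1) (hs : s ^ 2 = 1)
    (hp : 4 * q 0 + q 1 + 2 * t * q 2 + 2 * s * q 3 + 2 * t * s * q 4 ≠ 0)
    (hm : 4 * q 0 - q 1 + 2 * t * q 2 + 2 * s * q 3 + 2 * t * s * q 4 ≠ 0)
    (h1 : n 1 ^ 2 = t * n 0 ^ 2) (h2 : n 2 ^ 2 = s * n 0 ^ 2) (h3 : n 3 ^ 2 = t * s * n 0 ^ 2) :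
    False := by
  obtain ⟨hn, e, -⟩ := (singularPoint_iff q n).1 h
  have e' : (4 * q 0 + 2 * t * q 2 + 2 * s * q 3 + 2 * t * s * q 4) * n 0 ^ 4
      + q 1 * (n 0 * n 1 * n 2 * n 3) = 0 := by
    have h14 : n 1 ^ 4 = n 0 ^ 4 := by
      linear_combination (n 1 ^ 2 + t * n 0 ^ 2) * h1 + n 0 ^ 4 * ht
    have h24 : n 2 ^ 4 = n 0 ^ 4 := by
      linear_combination (n 2 ^ 2 + s * n 0 ^ 2) * h2 + n 0 ^ 4 * hs
    have h34 : n 3 ^ 4 = n 0 ^ 4 := by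
      linear_combination (n 3 ^ 2 + t * s * n 0 ^ 2) * h3 + n 0 ^ 4 * s ^ 2 * ht + n 0 ^ 4 * hs
    rw [h14, h24, h34, h1, h2, h3] at e
    linear_combination e - q 2 * t * n 0 ^ 4 * hs - q 3 * s * n 0 ^ 4 * ht
  -- The product of the coordinates is `± n 0 ^ 4`, so the quartic equation reduces to one of the
  -- two nonzero forms `hp`, `hm` times `n 0 ^ 4`.
  have e2 : (n 0 * n 1 * n 2 * n 3 - n 0 ^ 4) * (n 0 * n 1 * n 2 * n 3 + n 0 ^ 4) = 0 := by
    have : (n 0 * n 1 * n 2 * n 3) ^ 2 = n 0 ^ 8 := by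
      calc _ = n 0 ^ 2 * n 1 ^ 2 * n 2 ^ 2 * n 3 ^ 2 := by ring
        _ = t ^ 2 * s ^ 2 * n 0 ^ 8 := by rw [h1, h2, h3]; ring
        _ = _ := by rw [ht, hs]; ring
    linear_combination this
  have h0 : n 0 = 0 := by
    rcases mul_eq_zero.1 e2 with e2 | e2
    · have : (4 * q 0 + q 1 + 2 * t * q 2 + 2 * s * q 3 + 2 * t * s * q 4) * n 0 ^ 4 = 0 := by
        linear_combination e' - q 1 * e2
      simpa [hp] using this
    · have : (4 * q 0 - q 1 + 2 * t * q 2 + 2 * s * q 3 + 2 * t * s * q 4) * n 0 ^ 4 = 0 := by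
        linear_combination e' - q 1 * e2
      simpa [hm] using this
  apply hn
  ext i
  fin_cases i <;> simp_all

variable [CharZero L]

/-- The hypotheses concern the nine singular hyperplanes through `q₁`. Each of the other six cuts
the Segre cubic in three planes, and each plane lies in one of the nine or in a hyperplane already
excluded. -/
theorem offSingularHyperplanes_of_segre_eq_zero {q : Fin 5 → L} (h : segre q = 0)
    (hC : qPlusC q ≠ 0) (hD : qPlusD q ≠ 0) (hE : qMinusE q ≠ 0)
    (h0 : pPlus0 q ≠ 0) (h1 : pPlus1 q ≠ 0) (h2 : pPlus2 q ≠ 0)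
    (h0' : pMinus0 q ≠ 0) (h1' : pMinus1 q ≠ 0) (h2' : pMinus2 q ≠ 0) :
    OffSingularHyperplanes q := by
  simp only [OffSingularHyperplanes, segre, qPlusC, qMinusC, qPlusD, qMinusD, qPlusE, qMinusE,
    pPlus0, pPlus1, pPlus2, pPlus3, pMinus0, pMinus1, pMinus2, pMinus3] at *
  have hA : q 0 ≠ 0 := by
    intro hA
    have : (2 * q 0 + q 2) * (2 * q 0 + q 3) * (2 * q 0 - q 4) = 0 := by
      linear_combination (-1 / 4) * h + (12 * q 0 ^ 2 + 1 / 4 * q 1 ^ 2 - q 2 ^ 2 - q 3 ^ 2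
        - q 4 ^ 2 + 4 * q 0 * (q 2 + q 3 - q 4)
        + 2 * (q 2 * q 3 - q 2 * q 4 - q 3 * q 4)) * hA
    simp_all
  have hC' : 2 * q 0 - q 2 ≠ 0 := by
    intro hC'
    have e : q 2 = 2 * q 0 := by linear_combination -hC'
    have : q 0 * ((4 * q 0 + q 1 - 2 * q 2 + 2 * q 3 - 2 * q 4) *
        (4 * q 0 - q 1 - 2 * q 2 + 2 * q 3 - 2 * q 4)) = 0 := by
      rw [e] at h ⊢; linear_combination -h
    simp_all
  have hD' : 2 * q 0 - q 3 ≠ 0 := by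
    intro hD'
    have e : q 3 = 2 * q 0 := by linear_combination -hD'
    have : q 0 * ((4 * q 0 + q 1 + 2 * q 2 - 2 * q 3 - 2 * q 4) *
        (4 * q 0 - q 1 + 2 * q 2 - 2 * q 3 - 2 * q 4)) = 0 := by
      rw [e] at h ⊢; linear_combination -h
    simp_all
  have hE' : 2 * q 0 + q 4 ≠ 0 := by
    intro hE'
    have e : q 4 = -2 * q 0 := by linear_combination hE'
    have : q 0 * ((4 * q 0 + q 1 + 2 * q 2 + 2 * q 3 + 2 * q 4) *
        (4 * q 0 - q 1 + 2 * q 2 + 2 * q 3 + 2 * q 4)) = 0 := by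
      rw [e] at h ⊢; linear_combination -h
    simp_all
  -- Both signs of `B` are treated at once: `Δ` involves only `B ^ 2`, which `h3` eliminates.
  have h3 (s : L) (hs : s ^ 2 = 1) : 4 * q 0 + s * q 1 - 2 * q 2 - 2 * q 3 + 2 * q 4 ≠ 0 := by
    intro h3
    have e : q 1 ^ 2 = (4 * q 0 - 2 * q 2 - 2 * q 3 + 2 * q 4) ^ 2 := by
      linear_combination (s * q 1 - (4 * q 0 - 2 * q 2 - 2 * q 3 + 2 * q 4)) * h3 - q 1 ^ 2 * hs
    have : (2 * q 0 - q 2) * (2 * q 0 - q 3) * (2 * q 0 + q 4) = 0 := by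
      linear_combination (1 / 4) * h - (1 / 4) * q 0 * e
    simp_all
  refine ⟨hA, hC, hC', hD, hD', hE', hE, h0, h1, h2, ?_, h0', h1', h2', ?_⟩
  · simpa using h3 1 (by ring)
  · simpa [← sub_eq_add_neg] using h3 (-1) (by ring)

/-- The nine forms vanishing at `q₁` are only scaled by `beta p` on passing to `p₁`; the other six
are handled by `Δ(p₁) = 0`. -/
theorem offSingularHyperplanes_thirdPoint {p : Fin 5 → L} (hp : OffSingularHyperplanes p)
    (hβ : beta p ≠ 0) : OffSingularHyperplanes (thirdPoint p) := by
  obtain ⟨_, hC, _, hD, _, _, hE, h0, h1, h2, _, h0', h1', h2', _⟩ := hp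
  obtain ⟨eC, eD, eE, e0, e1, e2, e0', e1', e2'⟩ := hyperplanes_thirdPoint p
  apply offSingularHyperplanes_of_segre_eq_zero (segre_thirdPoint p) <;>
  simp_all

/-- Since `4 * (uC * vC) = s0 * sC - sD * sE`, vanishing of `uC * vC` would reduce the first
relation to `4 * A * s0 * sC = 0`; likewise for `D` and `E`. -/
theorem NodeRelations.offFundamentalQuadrics {q : Fin 5 → L} {n : Fin 4 → L}
    (h : NodeRelations q n) (hA : q 0 ≠ 0) (h0 : s0 n ≠ 0) (hC : sC n ≠ 0) (hD : sD n ≠ 0)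
    (hE : sE n ≠ 0) : OffFundamentalQuadrics n := by
  obtain ⟨rC, rD, rE⟩ := h
  have eC : 4 * (uC n * vC n) = s0 n * sC n - sD n * sE n := by
    simp only [uC, vC, s0, sC, sD, sE]; ring
  have eD : 4 * (uD n * vD n) = s0 n * sD n - sC n * sE n := by
    simp only [uD, vD, s0, sC, sD, sE]; ring
  have eE : 4 * (uE n * vE n) = s0 n * sE n - sC n * sD n := by
    simp only [uE, vE, s0, sC, sD, sE]; ring
  simp only [qPlusC, qMinusC, qPlusD, qMinusD, qPlusE, qMinusE] at rC rD rE
  have hPC : uC n * vC n ≠ 0 := by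
    intro h
    have : 4 * (q 0 * (s0 n * sC n)) = 0 := by
      linear_combination rC - (2 * q 0 - q 2) * eC + 4 * (2 * q 0 - q 2) * h
    simp [hA, h0, hC] at this
  have hPD : uD n * vD n ≠ 0 := by
    intro h
    have : 4 * (q 0 * (s0 n * sD n)) = 0 := by
      linear_combination rD - (2 * q 0 - q 3) * eD + 4 * (2 * q 0 - q 3) * h
    simp [hA, h0, hD] at this
  have hPE : uE n * vE n ≠ 0 := by
    intro h
    have : 4 * (q 0 * (s0 n * sE n)) = 0 := by
      linear_combination rE - (2 * q 0 - q 4) * eE + 4 * (2 * q 0 - q 4) * h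
    simp [hA, h0, hE] at this
  exact ⟨h0, hC, hD, hE, left_ne_zero_of_mul hPC, right_ne_zero_of_mul hPC,
    left_ne_zero_of_mul hPD, right_ne_zero_of_mul hPD,
    left_ne_zero_of_mul hPE, right_ne_zero_of_mul hPE⟩

/-- By the node relations, if one of `s0`, `sC`, `sD`, `sE` vanishes then so do at least three. The
coordinates then have equal squares up to sign, which `IsSingularPoint.not_sq_eq` forbids. -/
theorem IsSingularPoint.offFundamentalQuadrics {q : Fin 5 → L} {n : Fin 4 → L}
    (h : IsSingularPoint q n) (hq : OffSingularHyperplanes q) : OffFundamentalQuadrics n := by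
  have hr := h.nodeRelations
  obtain ⟨rC, rD, rE⟩ := h.nodeRelations
  obtain ⟨hA, hC, hC', hD, hD', hE, hE', h0, h1, h2, h3, h0', h1', h2', h3'⟩ := hq
  have k0 : ¬ (sC n = 0 ∧ sD n = 0 ∧ sE n = 0) := by
    rintro ⟨c, d, e⟩
    simp only [sC, sD, sE] at c d e
    refine h.not_sq_eq (t := 1) (s := 1) (by ring) (by ring) ?_ ?_ ?_ ?_ ?_
    · simpa [pPlus0] using h0
    · simpa [pMinus0] using h0'
    · linear_combination (-1 / 2) * d + (-1 / 2) * e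
    · linear_combination (-1 / 2) * c + (-1 / 2) * e
    · linear_combination (-1 / 2) * c + (-1 / 2) * d
  have kC : ¬ (s0 n = 0 ∧ sD n = 0 ∧ sE n = 0) := by
    rintro ⟨c, d, e⟩
    simp only [s0, sD, sE] at c d e
    refine h.not_sq_eq (t := 1) (s := -1) (by ring) (by ring) ?_ ?_ ?_ ?_ ?_
    · simpa [pPlus1, sub_eq_add_neg] using h1
    · simpa [pMinus1, sub_eq_add_neg] using h1'
    · linear_combination (-1 / 2) * d + (-1 / 2) * e
    · linear_combination (1 / 2) * c + (1 / 2) * d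
    · linear_combination (1 / 2) * c + (1 / 2) * e
  have kD : ¬ (s0 n = 0 ∧ sC n = 0 ∧ sE n = 0) := by
    rintro ⟨c, d, e⟩
    simp only [s0, sC, sE] at c d e
    refine h.not_sq_eq (t := -1) (s := 1) (by ring) (by ring) ?_ ?_ ?_ ?_ ?_
    · simpa [pPlus2, sub_eq_add_neg] using h2
    · simpa [pMinus2, sub_eq_add_neg] using h2'
    · linear_combination (1 / 2) * c + (1 / 2) * d
    · linear_combination (-1 / 2) * d + (-1 / 2) * e
    · linear_combination (1 / 2) * c + (1 / 2) * e
  have kE : ¬ (s0 n = 0 ∧ sC n = 0 ∧ sD n = 0) := by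
    rintro ⟨c, d, e⟩
    simp only [s0, sC, sD] at c d e
    refine h.not_sq_eq (t := -1) (s := -1) (by ring) (by ring) ?_ ?_ ?_ ?_ ?_
    · simpa [pPlus3, sub_eq_add_neg] using h3
    · simpa [pMinus3, sub_eq_add_neg] using h3'
    · linear_combination (1 / 2) * c + (1 / 2) * d
    · linear_combination (1 / 2) * c + (1 / 2) * e
    · linear_combination (-1 / 2) * d + (-1 / 2) * e
  have key {x y u v r t : L} (hr : r ≠ 0) (ht : t ≠ 0) (e : r * (x * y) + t * (u * v) = 0) :
      (x = 0 ∨ y = 0) ↔ (u = 0 ∨ v = 0) := by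
    rw [← mul_eq_zero, ← mul_eq_zero]
    constructor <;> intro h' <;> rw [h'] at e <;> simpa [hr, ht] using e
  replace rC := key hC hC' rC
  replace rD := key hD hD' rD
  replace rE := key hE hE' rE
  clear * - hr hA k0 kC kD kE rC rD rE
  have : s0 n ≠ 0 ∧ sC n ≠ 0 ∧ sD n ≠ 0 ∧ sE n ≠ 0 := by
    clear hr hA
    by_cases s0 n = 0 <;> by_cases sC n = 0 <;> by_cases sD n = 0 <;> by_cases sE n = 0 <;>
      simp_all
  exact hr.offFundamentalQuadrics hA this.1 this.2.1 this.2.2.1 this.2.2.2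

theorem NodeRelations.coeff_eq {q : Fin 5 → L} {n : Fin 4 → L} (h : NodeRelations q n) :
    q 2 * (uC n * vC n) = q 0 * (n 2 ^ 4 + n 3 ^ 4 - n 0 ^ 4 - n 1 ^ 4) ∧
    q 3 * (uD n * vD n) = q 0 * (n 1 ^ 4 + n 3 ^ 4 - n 0 ^ 4 - n 2 ^ 4) ∧
    q 4 * (uE n * vE n) = q 0 * (n 1 ^ 4 + n 2 ^ 4 - n 0 ^ 4 - n 3 ^ 4) := by
  obtain ⟨rC, rD, rE⟩ := h
  simp only [s0, sC, sD, sE, uC, vC, uD, vD, uE, vE, qPlusC, qMinusC, qPlusD, qMinusD, qPlusE,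
    qMinusE] at *
  refine ⟨?_, ?_, ?_⟩
  · linear_combination (1 / 4) * rC
  · linear_combination (1 / 4) * rD
  · linear_combination (1 / 4) * rE

/-- The Heisenberg invariant Kummer surface is determined by any of its nodes. -/
theorem IsSingularPoint.exists_eq_smul_kummer {q : Fin 5 → L} {n : Fin 4 → L}
    (h : IsSingularPoint q n) (hq : OffSingularHyperplanes q) :
    ∃ t : L, t ≠ 0 ∧ q = t • kummer n := by
  have hn := h.offFundamentalQuadrics hq
  obtain ⟨hC, hD, hE⟩ := h.nodeRelations.coeff_eq
  obtain ⟨-, -, e0, e1, e2, e3⟩ := (singularPoint_iff q n).1 h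
  have nC : uC n * vC n ≠ 0 := mul_ne_zero hn.uC hn.vC
  have nD : uD n * vD n ≠ 0 := mul_ne_zero hn.uD hn.vD
  have nE : uE n * vE n ≠ 0 := mul_ne_zero hn.uE hn.vE
  set PC := uC n * vC n with hPC
  set PD := uD n * vD n with hPD
  set PE := uE n * vE n with hPE
  -- `Z = 0` is the formula for `B`, the only parameter not given by the node relations. Each
  -- partial derivative yields `Z` times three of the coordinates.
  set Z := q 1 * (PC * PD * PE)
    - q 0 * (2 * (n 0 * n 1 * n 2 * n 3) * (s0 n * sC n * sD n * sE n)) with hZ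
  have z0 : n 1 * n 2 * n 3 * Z = 0 := by
    rw [hZ]
    linear_combination PC * PD * PE * e0
      - 2 * n 0 * n 1 ^ 2 * PD * PE * hC - 2 * n 0 * n 2 ^ 2 * PC * PE * hD
      - 2 * n 0 * n 3 ^ 2 * PC * PD * hE + q 0 * (by
        simp only [hPC, hPD, hPE, s0, sC, sD, sE, uC, vC, uD, vD, uE, vE]; ring :
        - 4 * n 0 ^ 3 * (PC * PD * PE)
        - 2 * n 0 * n 1 ^ 2 * PD * PE * (n 2 ^ 4 + n 3 ^ 4 - n 0 ^ 4 - n 1 ^ 4)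
        - 2 * n 0 * n 2 ^ 2 * PC * PE * (n 1 ^ 4 + n 3 ^ 4 - n 0 ^ 4 - n 2 ^ 4)
        - 2 * n 0 * n 3 ^ 2 * PC * PD * (n 1 ^ 4 + n 2 ^ 4 - n 0 ^ 4 - n 3 ^ 4)
        = n 1 * n 2 * n 3 * (2 * (n 0 * n 1 * n 2 * n 3) * (s0 n * sC n * sD n * sE n)))
  have z1 : n 0 * n 2 * n 3 * Z = 0 := by
    rw [hZ]
    linear_combination PC * PD * PE * e1
      - 2 * n 1 * n 0 ^ 2 * PD * PE * hC - 2 * n 1 * n 3 ^ 2 * PC * PE * hD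
      - 2 * n 1 * n 2 ^ 2 * PC * PD * hE + q 0 * (by
        simp only [hPC, hPD, hPE, s0, sC, sD, sE, uC, vC, uD, vD, uE, vE]; ring :
        - 4 * n 1 ^ 3 * (PC * PD * PE)
        - 2 * n 1 * n 0 ^ 2 * PD * PE * (n 2 ^ 4 + n 3 ^ 4 - n 0 ^ 4 - n 1 ^ 4)
        - 2 * n 1 * n 3 ^ 2 * PC * PE * (n 1 ^ 4 + n 3 ^ 4 - n 0 ^ 4 - n 2 ^ 4)
        - 2 * n 1 * n 2 ^ 2 * PC * PD * (n 1 ^ 4 + n 2 ^ 4 - n 0 ^ 4 - n 3 ^ 4)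
        = n 0 * n 2 * n 3 * (2 * (n 0 * n 1 * n 2 * n 3) * (s0 n * sC n * sD n * sE n)))
  have z2 : n 0 * n 1 * n 3 * Z = 0 := by
    rw [hZ]
    linear_combination PC * PD * PE * e2
      - 2 * n 2 * n 3 ^ 2 * PD * PE * hC - 2 * n 2 * n 0 ^ 2 * PC * PE * hD
      - 2 * n 2 * n 1 ^ 2 * PC * PD * hE + q 0 * (by
        simp only [hPC, hPD, hPE, s0, sC, sD, sE, uC, vC, uD, vD, uE, vE]; ring :
        - 4 * n 2 ^ 3 * (PC * PD * PE)
        - 2 * n 2 * n 3 ^ 2 * PD * PE * (n 2 ^ 4 + n 3 ^ 4 - n 0 ^ 4 - n 1 ^ 4)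
        - 2 * n 2 * n 0 ^ 2 * PC * PE * (n 1 ^ 4 + n 3 ^ 4 - n 0 ^ 4 - n 2 ^ 4)
        - 2 * n 2 * n 1 ^ 2 * PC * PD * (n 1 ^ 4 + n 2 ^ 4 - n 0 ^ 4 - n 3 ^ 4)
        = n 0 * n 1 * n 3 * (2 * (n 0 * n 1 * n 2 * n 3) * (s0 n * sC n * sD n * sE n)))
  have z3 : n 0 * n 1 * n 2 * Z = 0 := by
    rw [hZ]
    linear_combination PC * PD * PE * e3
      - 2 * n 3 * n 2 ^ 2 * PD * PE * hC - 2 * n 3 * n 1 ^ 2 * PC * PE * hD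
      - 2 * n 3 * n 0 ^ 2 * PC * PD * hE + q 0 * (by
        simp only [hPC, hPD, hPE, s0, sC, sD, sE, uC, vC, uD, vD, uE, vE]; ring :
        - 4 * n 3 ^ 3 * (PC * PD * PE)
        - 2 * n 3 * n 2 ^ 2 * PD * PE * (n 2 ^ 4 + n 3 ^ 4 - n 0 ^ 4 - n 1 ^ 4)
        - 2 * n 3 * n 1 ^ 2 * PC * PE * (n 1 ^ 4 + n 3 ^ 4 - n 0 ^ 4 - n 2 ^ 4)
        - 2 * n 3 * n 0 ^ 2 * PC * PD * (n 1 ^ 4 + n 2 ^ 4 - n 0 ^ 4 - n 3 ^ 4)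
        = n 0 * n 1 * n 2 * (2 * (n 0 * n 1 * n 2 * n 3) * (s0 n * sC n * sD n * sE n)))
  have hB : Z = 0 := by
    -- Coordinates may vanish, so no triple product can be cancelled; but the nonzero `PC * PD` is a
    -- combination of the four triple products.
    have : Z * (PC * PD) = 0 := by
      have e : PC * PD = n 0 ^ 4 * n 1 ^ 2 * n 2 ^ 2 - n 0 ^ 2 * n 1 ^ 4 * n 3 ^ 2
          - n 0 ^ 2 * n 2 ^ 4 * n 3 ^ 2 + n 1 ^ 2 * n 2 ^ 2 * n 3 ^ 4 := by
        simp only [hPC, hPD, uC, vC, uD, vD]; ring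
      rw [e]
      linear_combination n 0 ^ 3 * n 1 * n 2 * z3 - n 0 * n 1 ^ 3 * n 3 * z2
        - n 0 * n 2 ^ 3 * n 3 * z1 + n 1 * n 2 * n 3 ^ 3 * z0
    simpa [nC, nD] using this
  refine ⟨q 0 / (PC * PD * PE), div_ne_zero hq.1 (mul_ne_zero (mul_ne_zero nC nD) nE), ?_⟩
  ext i
  fin_cases i <;> simp only [kummer, ← hPC, ← hPD, ← hPE, Pi.smul_apply, smul_eq_mul, Fin.zero_eta,
    Fin.mk_one, Fin.reduceFinMk, Matrix.cons_val] <;> field_simp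
  · linear_combination hB
  · linear_combination hC
  · linear_combination hD
  · linear_combination hE

end Nodes

/-! ### Existence of a singular point. -/

section Existence

variable {L : Type*} [Field L]

theorem kummer_neg_coord (n : Fin 4 → L) :
    kummer ![-n 0, n 1, n 2, n 3] =
      ![kummer n 0, -kummer n 1, kummer n 2, kummer n 3, kummer n 4] := by
  ext i
  fin_cases i <;>
  simp only [kummer, s0, sC, sD, sE, uC, vC, uD, vD, uE, vE, Fin.zero_eta,
    Fin.mk_one, Fin.reduceFinMk, Matrix.cons_val] <;> ring

theorem IsSingularPoint.smul {q : Fin 5 → L} {n : Fin 4 → L}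
    (h : IsSingularPoint q n) {t : L} (ht : t ≠ 0) : IsSingularPoint q (t • n) := by
  rw [singularPoint_iff] at h ⊢
  obtain ⟨hn, e, e0, e1, e2, e3⟩ := h
  simp only [Pi.smul_apply, smul_eq_mul]
  refine ⟨smul_ne_zero ht hn, ?_, ?_, ?_, ?_, ?_⟩
  · linear_combination t ^ 4 * e
  · linear_combination t ^ 3 * e0
  · linear_combination t ^ 3 * e1
  · linear_combination t ^ 3 * e2
  · linear_combination t ^ 3 * e3

variable [CharZero L]

/-- The relations fix `A, C, D, E` up to a common scalar, and `Δ = 0` then fixes `B` up to sign.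
Changing the sign of one coordinate of `n` corrects the sign of `B`. -/
theorem NodeRelations.exists_singularPoint {q : Fin 5 → L} {n : Fin 4 → L}
    (h : NodeRelations q n) (hA : q 0 ≠ 0) (hq : segre q = 0)
    (h0 : s0 n ≠ 0) (hC : sC n ≠ 0) (hD : sD n ≠ 0) (hE : sE n ≠ 0) :
    ∃ n, IsSingularPoint q n := by
  have hn := h.offFundamentalQuadrics hA h0 hC hD hE
  obtain ⟨eC, eD, eE⟩ := h.coeff_eq
  have nC : uC n * vC n ≠ 0 := mul_ne_zero hn.uC hn.vC
  have nD : uD n * vD n ≠ 0 := mul_ne_zero hn.uD hn.vD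
  have nE : uE n * vE n ≠ 0 := mul_ne_zero hn.uE hn.vE
  have hn0 : n ≠ 0 := by
    rintro rfl
    simp [s0] at h0
  obtain ⟨-, -, -, -, hn1, hn2, hn3, hn4, hn5, hn6⟩ := hn
  obtain ⟨t, ht⟩ : ∃ t : L, t = q 0 / (uC n * vC n * (uD n * vD n) * (uE n * vE n)) := ⟨_, rfl⟩
  have c0 : q 0 = t * kummer n 0 := by
    rw [ht]; simp only [kummer, Matrix.cons_val]; field_simp
  have c2 : q 2 = t * kummer n 2 := by
    rw [ht]; simp only [kummer, Matrix.cons_val]; field_simp; linear_combination eC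
  have c3 : q 3 = t * kummer n 3 := by
    rw [ht]; simp only [kummer, Matrix.cons_val]; field_simp; linear_combination eD
  have c4 : q 4 = t * kummer n 4 := by
    rw [ht]; simp only [kummer, Matrix.cons_val]; field_simp; linear_combination eE
  have hk : segre (t • kummer n) = 0 := by rw [segre_smul, segre_kummer, mul_zero]
  have hB : q 1 ^ 2 = (t * kummer n 1) ^ 2 := by
    simp only [segre, Pi.smul_apply, smul_eq_mul] at hk hq
    rw [← c0, ← c2, ← c3, ← c4] at hk
    exact mul_left_cancel₀ hA (by linear_combination hq - hk)
  rcases sq_eq_sq_iff_eq_or_eq_neg.1 hB with c1 | c1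
  · refine ⟨n, ?_⟩
    have : q = t • kummer n := by
      ext i; fin_cases i <;> assumption
    exact this ▸ singularPoint_kummer hn0 t
  · refine ⟨![-n 0, n 1, n 2, n 3], ?_⟩
    have : q = t • kummer ![-n 0, n 1, n 2, n 3] := by
      rw [kummer_neg_coord]
      ext i; fin_cases i <;> simp [c0, c1, c2, c3, c4]
    refine this ▸ singularPoint_kummer (fun h => hn0 ?_) t
    ext i
    have := congrFun h i
    fin_cases i <;> simpa using this

theorem exists_singularPoint [IsAlgClosed L] {q : Fin 5 → L} (hq : OffSingularHyperplanes q)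
    (hs : segre q = 0) : ∃ n, IsSingularPoint q n := by
  obtain ⟨hA, hC, hC', hD, hD', hE, hE', -⟩ := hq
  -- With `s0 = 1`, the node relations become equations in `c = sC`, `d = sD`, `e = sE`. Eliminating
  -- `c` gives `d ^ 2` and `e ^ 2`, and the first relation then gives `c`.
  obtain ⟨e, he⟩ := IsAlgClosed.exists_pow_nat_eq
    (qPlusC q * qPlusD q / (qMinusC q * qMinusD q)) two_pos
  obtain ⟨d, hd⟩ := IsAlgClosed.exists_pow_nat_eq
    (qPlusC q * qPlusE q / (qMinusC q * qMinusE q)) two_pos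
  have ne : e ≠ 0 := by
    rintro rfl
    simp_all [eq_comm]
  have nd : d ≠ 0 := by
    rintro rfl
    simp_all [eq_comm]
  obtain ⟨c, hc⟩ : ∃ c, c = - qMinusC q / qPlusC q * d * e := ⟨_, rfl⟩
  have nc : c ≠ 0 := by
    rw [hc]; simp [hC, hC', ne, nd]
  -- Squares of the coordinates, from inverting the linear map that sends them to `s0`, `sC`, `sD`,
  -- `sE`.
  obtain ⟨n0, e0⟩ := IsAlgClosed.exists_pow_nat_eq ((1 + c + d + e) / 4) two_pos
  obtain ⟨n1, e1⟩ := IsAlgClosed.exists_pow_nat_eq ((1 + c - d - e) / 4) two_pos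
  obtain ⟨n2, e2⟩ := IsAlgClosed.exists_pow_nat_eq ((1 - c + d - e) / 4) two_pos
  obtain ⟨n3, e3⟩ := IsAlgClosed.exists_pow_nat_eq ((1 - c - d + e) / 4) two_pos
  obtain ⟨n, hn⟩ : ∃ n, n = ![n0, n1, n2, n3] := ⟨_, rfl⟩
  have f0 : s0 n = 1 := by
    simp only [hn, s0, Matrix.cons_val]; rw [e0, e1, e2, e3]; ring
  have fC : sC n = c := by
    simp only [hn, sC, Matrix.cons_val]; rw [e0, e1, e2, e3]; ring
  have fD : sD n = d := by
    simp only [hn, sD, Matrix.cons_val]; rw [e0, e1, e2, e3]; ring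
  have fE : sE n = e := by
    simp only [hn, sE, Matrix.cons_val]; rw [e0, e1, e2, e3]; ring
  refine NodeRelations.exists_singularPoint (n := n) ?_ hA hs (by simp [f0]) (fC ▸ nc) (fD ▸ nd)
    (fE ▸ ne)
  field_simp at he hd hc
  refine ⟨?_, ?_, ?_⟩
  · rw [f0, fC, fD, fE]
    linear_combination hc
  · rw [f0, fC, fD, fE]
    refine mul_left_cancel₀ hC (sub_eq_zero.1 ?_)
    linear_combination d * (-he) + (e * qMinusD q) * hc
  · rw [f0, fC, fD, fE]
    refine mul_left_cancel₀ hC (sub_eq_zero.1 ?_)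
    linear_combination e * (-hd) + (d * qMinusE q) * hc

end Existence

/-! ### The Heisenberg group action. -/

section Heisenberg

variable {R : Type*} [CommRing R]

/-- The double transpositions of the coordinates. -/
def heisPerm : Fin 4 → Fin 4 → Fin 4 :=
  ![![0, 1, 2, 3], ![1, 0, 3, 2], ![2, 3, 0, 1], ![3, 2, 1, 0]]

/-- The even sign changes of the coordinates, up to a common sign. -/
def heisSign (R : Type*) [CommRing R] : Fin 4 → Fin 4 → R :=
  ![![1, 1, 1, 1], ![1, 1, -1, -1], ![1, -1, 1, -1], ![1, -1, -1, 1]]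

/-- The action of the Heisenberg group, modulo scalars, on points. -/
def heis (g : Fin 4 × Fin 4) (n : Fin 4 → R) : Fin 4 → R :=
  fun k => heisSign R g.2 k * n (heisPerm g.1 k)

theorem s0_smul (t : R) (n : Fin 4 → R) : s0 (t • n) = t ^ 2 * s0 n := by
  simp only [s0, Pi.smul_apply, smul_eq_mul]; ring

theorem kummer_smul (t : R) (n : Fin 4 → R) : kummer (t • n) = t ^ 12 • kummer n := by
  ext i
  fin_cases i <;>
  simp only [kummer, s0, sC, sD, sE, uC, vC, uD, vD, uE, vE, Fin.zero_eta, Pi.smul_apply,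
    smul_eq_mul, Fin.mk_one, Fin.reduceFinMk, Matrix.cons_val] <;> ring

theorem kummer_heis (g : Fin 4 × Fin 4) (n : Fin 4 → R) : kummer (heis g n) = kummer n := by
  obtain ⟨i, j⟩ := g
  ext k
  fin_cases i <;> fin_cases j <;> fin_cases k <;>
  simp only [kummer, heis, heisPerm, heisSign, s0, sC, sD, sE, uC, vC, uD, vD, uE, vE, Fin.zero_eta,
    Fin.mk_one, Fin.reduceFinMk, Matrix.cons_val] <;> ring

theorem s0_heis (g : Fin 4 × Fin 4) (n : Fin 4 → R) : s0 (heis g n) = s0 n := by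
  obtain ⟨i, j⟩ := g
  fin_cases i <;> fin_cases j <;>
  simp only [s0, heis, heisPerm, heisSign, Fin.zero_eta,
    Fin.mk_one, Fin.reduceFinMk, Matrix.cons_val] <;> ring

/-- The rows of `heisSign` also serve as characters: `sC`, `sD`, `sE` see only the permutation part
of `g`, and `uC`, `uD` only the sign part. Together they separate the sixteen elements. -/
theorem sC_heis (g : Fin 4 × Fin 4) (n : Fin 4 → R) :
    sC (heis g n) = heisSign R 1 g.1 * sC n := by
  obtain ⟨i, j⟩ := g
  fin_cases i <;> fin_cases j <;>
  simp only [sC, heis, heisPerm, heisSign, Fin.zero_eta,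
    Fin.mk_one, Fin.reduceFinMk, Matrix.cons_val] <;> ring

theorem sD_heis (g : Fin 4 × Fin 4) (n : Fin 4 → R) :
    sD (heis g n) = heisSign R 2 g.1 * sD n := by
  obtain ⟨i, j⟩ := g
  fin_cases i <;> fin_cases j <;>
  simp only [sD, heis, heisPerm, heisSign, Fin.zero_eta,
    Fin.mk_one, Fin.reduceFinMk, Matrix.cons_val] <;> ring

theorem sE_heis (g : Fin 4 × Fin 4) (n : Fin 4 → R) :
    sE (heis g n) = heisSign R 3 g.1 * sE n := by
  obtain ⟨i, j⟩ := g
  fin_cases i <;> fin_cases j <;>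
  simp only [sE, heis, heisPerm, heisSign, Fin.zero_eta,
    Fin.mk_one, Fin.reduceFinMk, Matrix.cons_val] <;> ring

theorem uC_heis (g : Fin 4 × Fin 4) (n : Fin 4 → R) :
    uC (heis g n) = heisSign R 1 g.2 * uC n := by
  obtain ⟨i, j⟩ := g
  fin_cases i <;> fin_cases j <;>
  simp only [uC, heis, heisPerm, heisSign, Fin.zero_eta,
    Fin.mk_one, Fin.reduceFinMk, Matrix.cons_val] <;> ring

theorem uD_heis (g : Fin 4 × Fin 4) (n : Fin 4 → R) :
    uD (heis g n) = heisSign R 2 g.2 * uD n := by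
  obtain ⟨i, j⟩ := g
  fin_cases i <;> fin_cases j <;>
  simp only [uD, heis, heisPerm, heisSign, Fin.zero_eta,
    Fin.mk_one, Fin.reduceFinMk, Matrix.cons_val] <;> ring

end Heisenberg

/-! ### The singular points form one Heisenberg orbit of sixteen points. -/

section Classification

variable {L : Type*} [Field L] [CharZero L]

theorem heisSign_injective {i j : Fin 4} (h1 : heisSign L 1 i = heisSign L 1 j)
    (h2 : heisSign L 2 i = heisSign L 2 j) : i = j := by
  have e : (1 : L) ≠ -1 := by norm_num
  fin_cases i <;> fin_cases j <;> first | rfl | (exfalso; simp [heisSign, e, e.symm] at h1 h2)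

/-- The sixteen translates of a node are different points. -/
theorem heis_injective {n : Fin 4 → L} (hn : OffFundamentalQuadrics n) {g g' : Fin 4 × Fin 4}
    {t : L} (h : heis g n = t • heis g' n) : g = g' := by
  -- The invariant `s0` gives `t ^ 2 = 1`, so the scalar is invisible to the other quadrics and the
  -- characters of `g` and `g'` agree.
  have ht : t ^ 2 = 1 := by
    have := congrArg s0 h
    rw [s0_smul, s0_heis, s0_heis] at this
    exact mul_right_cancel₀ hn.s0 (by rw [← this, one_mul])
  have key {f : (Fin 4 → L) → L} {a b : L} (hf : f (t • heis g' n) = t ^ 2 * f (heis g' n))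
      (ha : f (heis g n) = a * f n) (hb : f (heis g' n) = b * f n) (h0 : f n ≠ 0) : a = b := by
    rw [ht, one_mul, ← h, ha, hb] at hf
    exact mul_right_cancel₀ h0 hf
  refine Prod.ext (heisSign_injective (L := L) ?_ ?_) (heisSign_injective (L := L) ?_ ?_)
  · exact key (by simp only [sC, Pi.smul_apply, smul_eq_mul]; ring) (sC_heis g n) (sC_heis g' n)
      hn.sC
  · exact key (by simp only [sD, Pi.smul_apply, smul_eq_mul]; ring) (sD_heis g n) (sD_heis g' n)
      hn.sD
  · exact key (by simp only [uC, Pi.smul_apply, smul_eq_mul]; ring) (uC_heis g n) (uC_heis g' n)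
      hn.uC
  · exact key (by simp only [uD, Pi.smul_apply, smul_eq_mul]; ring) (uD_heis g n) (uD_heis g' n)
      hn.uD

/-- Sign vectors with product `1` are the rows of `heisSign` up to a common sign. If the product is
`-1`, some coordinate is zero and its sign may be flipped freely. -/
theorem exists_smul_heisSign {m n : Fin 4 → L} (h : ∀ k, n k ^ 2 = m k ^ 2)
    (hp : n 0 * n 1 * n 2 * n 3 = m 0 * m 1 * m 2 * m 3) :
    ∃ (j : Fin 4) (t : L), t ≠ 0 ∧ ∀ k, n k = t * (heisSign L j k * m k) := by
  have key (e : Fin 4 → L) (he : ∀ k, e k = 1 ∨ e k = -1) (h1 : e 0 * e 1 * e 2 * e 3 = 1)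
      (hn : ∀ k, n k = e k * m k) :
      ∃ (j : Fin 4) (t : L), t ≠ 0 ∧ ∀ k, n k = t * (heisSign L j k * m k) := by
    have h11 : (-1 : L) ≠ 1 := by norm_num
    have hj : ∃ j, ∀ k, e k = e 0 * heisSign L j k := by
      rw [Fin.exists_fin_succ, Fin.exists_fin_succ, Fin.exists_fin_succ, Fin.exists_fin_one]
      simp only [Fin.forall_fin_succ, heisSign]
      rcases he 0 with e0 | e0 <;> rcases he 1 with e1 | e1 <;> rcases he 2 with e2 | e2 <;>
        rcases he 3 with e3 | e3 <;> simp_all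
    obtain ⟨j, hj⟩ := hj
    refine ⟨j, e 0, ?_, fun k => ?_⟩
    · rcases he 0 with e0 | e0 <;> simp [e0]
    · rw [hn, hj, mul_assoc]
  have hs (k) : ∃ e : L, (e = 1 ∨ e = -1) ∧ n k = e * m k := by
    rcases sq_eq_sq_iff_eq_or_eq_neg.1 (h k) with h | h
    · exact ⟨1, by simp [h]⟩
    · exact ⟨-1, by simp [h]⟩
  choose e he hn using hs
  have he2 : e 0 * e 1 * e 2 * e 3 = 1 ∨ e 0 * e 1 * e 2 * e 3 = -1 := by
    rcases he 0 with e0 | e0 <;> rcases he 1 with e1 | e1 <;> rcases he 2 with e2 | e2 <;>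
      rcases he 3 with e3 | e3 <;> simp [e0, e1, e2, e3]
  rcases he2 with he2 | he2
  · exact key e he he2 hn
  · have hz : m 0 * m 1 * m 2 * m 3 = 0 := by
      have : 2 * (m 0 * m 1 * m 2 * m 3) = 0 := by
        rw [hn 0, hn 1, hn 2, hn 3] at hp
        linear_combination -hp + m 0 * m 1 * m 2 * m 3 * he2
      simpa using this
    obtain ⟨k, hk⟩ : ∃ k, m k = 0 := by
      simp only [mul_eq_zero, or_assoc] at hz
      rcases hz with h | h | h | h <;> exact ⟨_, h⟩
    refine key (Function.update e k (-e k)) (fun i => ?_) ?_ fun i => ?_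
    · rcases eq_or_ne i k with rfl | hi
      · rcases he i with h | h <;> simp [h]
      · simpa [hi] using he i
    · fin_cases k <;> simp [Function.update] <;> linear_combination -he2
    · rcases eq_or_ne i k with rfl | hi
      · simp [hn i, hk]
      · simpa [hi] using hn i

theorem IsSingularPoint.heis {q : Fin 5 → L} {n : Fin 4 → L}
    (h : IsSingularPoint q n) (hq : OffSingularHyperplanes q) (g : Fin 4 × Fin 4) :
    IsSingularPoint q (heis g n) := by
  have hn := h.offFundamentalQuadrics hq
  obtain ⟨t, -, rfl⟩ := h.exists_eq_smul_kummer hq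
  rw [← kummer_heis g]
  refine singularPoint_kummer (fun h0 => hn.s0 ?_) t
  rw [← s0_heis g, h0]
  simp [s0]

/-- Given `s0`, the node relations determine `sD ^ 2` and `sE ^ 2`. A double transposition matches
the signs of `sD` and `sE`, the first relation then matches `sC`, and the squares of all coordinates
agree. -/
theorem IsSingularPoint.exists_heis_of_s0_eq {q : Fin 5 → L} {n m : Fin 4 → L}
    (hn : IsSingularPoint q n) (hm : IsSingularPoint q m) (hq : OffSingularHyperplanes q)
    (hs : s0 n = s0 m) :
    ∃ (g : Fin 4 × Fin 4) (t : L), t ≠ 0 ∧ n = t • HeisenbergQuartic.heis g m := by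
  obtain ⟨rC, rD, rE⟩ := hn.nodeRelations
  obtain ⟨rC', rD', rE'⟩ := hm.nodeRelations
  have on := hn.offFundamentalQuadrics hq
  have om := hm.offFundamentalQuadrics hq
  obtain ⟨_, hC, hC', hD, hD', hE, hE', -⟩ := id hq
  have key {C C' D D' s c d e : L} (hC' : C' ≠ 0) (hD' : D' ≠ 0) (hc : c ≠ 0) (hd : d ≠ 0)
      (h1 : C * (s * c) + C' * (d * e) = 0) (h2 : D * (s * d) + D' * (c * e) = 0) :
      e ^ 2 = C * D * s ^ 2 / (C' * D') := by
    field_simp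
    refine mul_left_cancel₀ (mul_ne_zero hc hd) ?_
    linear_combination C' * d * e * h2 - D * s * d * h1
  have eE : sE n ^ 2 = sE m ^ 2 := by
    rw [key hC' hD' on.sC on.sD rC rD, key hC' hD' om.sC om.sD rC' rD', hs]
  have eD : sD n ^ 2 = sD m ^ 2 := by
    rw [key (C := qPlusC q) (s := s0 n) hC' hE' on.sC on.sE (by linear_combination rC) rE,
      key (C := qPlusC q) (s := s0 m) hC' hE' om.sC om.sE (by linear_combination rC') rE', hs]
  have hg : ∃ i : Fin 4, sD n = heisSign L 2 i * sD m ∧ sE n = heisSign L 3 i * sE m := by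
    rcases sq_eq_sq_iff_eq_or_eq_neg.1 eD with h | h <;>
    rcases sq_eq_sq_iff_eq_or_eq_neg.1 eE with h' | h'
    · exact ⟨0, by simp [h, h', heisSign]⟩
    · exact ⟨2, by simp [h, h', heisSign]⟩
    · exact ⟨3, by simp [h, h', heisSign]⟩
    · exact ⟨1, by simp [h, h', heisSign]⟩
  obtain ⟨i, fD, fE⟩ := hg
  have hm' := hm.heis hq (i, 0)
  obtain ⟨rC', -, -⟩ := hm'.nodeRelations
  have om' := hm'.offFundamentalQuadrics hq
  have f0 := s0_heis (i, 0) m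
  rw [← hs] at f0
  rw [← sD_heis (i, 0)] at fD
  rw [← sE_heis (i, 0)] at fE
  have fC : sC n = sC (HeisenbergQuartic.heis (i, 0) m) := by
    refine mul_left_cancel₀ (mul_ne_zero hC on.s0) ?_
    rw [f0, ← fD, ← fE] at rC'
    linear_combination rC - rC'
  have hheis (j k) : HeisenbergQuartic.heis (i, j) m k
      = heisSign L j k * HeisenbergQuartic.heis (i, 0) m k := by
    have : heisSign L 0 k = 1 := by fin_cases k <;> rfl
    simp [HeisenbergQuartic.heis, this]
  obtain ⟨m', hm'_eq⟩ : ∃ m', m' = HeisenbergQuartic.heis (i, 0) m := ⟨_, rfl⟩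
  rw [← hm'_eq] at fC fD fE f0 hm' om'
  simp only [← hm'_eq] at hheis
  have hsq (k) : n k ^ 2 = m' k ^ 2 := by
    simp only [s0, sC, sD, sE] at f0 fC fD fE
    fin_cases k <;> simp only [Fin.zero_eta, Fin.mk_one, Fin.reduceFinMk]
    · linear_combination (-f0 + fC + fD + fE) / 4
    · linear_combination (-f0 + fC - fD - fE) / 4
    · linear_combination (-f0 - fC + fD - fE) / 4
    · linear_combination (-f0 - fC - fD + fE) / 4
  -- `A` and `B` of `kummer` are compared: all factors other than the product of the coordinates
  -- already agree.
  have hprod : n 0 * n 1 * n 2 * n 3 = m' 0 * m' 1 * m' 2 * m' 3 := by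
    obtain ⟨t, ht, e⟩ := hn.exists_eq_smul_kummer hq
    obtain ⟨t', ht', e'⟩ := hm'.exists_eq_smul_kummer hq
    have ePC (n : Fin 4 → L) : uC n * vC n = n 0 ^ 2 * n 1 ^ 2 - n 2 ^ 2 * n 3 ^ 2 := by
      simp only [uC, vC]; ring
    have ePD (n : Fin 4 → L) : uD n * vD n = n 0 ^ 2 * n 2 ^ 2 - n 1 ^ 2 * n 3 ^ 2 := by
      simp only [uD, vD]; ring
    have ePE (n : Fin 4 → L) : uE n * vE n = n 0 ^ 2 * n 3 ^ 2 - n 1 ^ 2 * n 2 ^ 2 := by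
      simp only [uE, vE]; ring
    have gC : uC m' * vC m' = uC n * vC n := by rw [ePC, ePC, hsq, hsq, hsq, hsq]
    have gD : uD m' * vD m' = uD n * vD n := by rw [ePD, ePD, hsq, hsq, hsq, hsq]
    have gE : uE m' * vE m' = uE n * vE n := by rw [ePE, ePE, hsq, hsq, hsq, hsq]
    have e0 := congrFun (e.symm.trans e') 0
    have e1 := congrFun (e.symm.trans e') 1
    simp only [kummer, Pi.smul_apply, smul_eq_mul, Matrix.cons_val, gC, gD, gE, f0, ← fC, ← fD,
      ← fE] at e0 e1
    have htt : t = t' := mul_right_cancel₀ (mul_ne_zero (mul_ne_zero (mul_ne_zero on.uC on.vC)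
      (mul_ne_zero on.uD on.vD)) (mul_ne_zero on.uE on.vE)) e0
    subst htt
    have hS : s0 n * sC n * sD n * sE n ≠ 0 :=
      mul_ne_zero (mul_ne_zero (mul_ne_zero on.s0 on.sC) on.sD) on.sE
    have := mul_right_cancel₀ hS (mul_left_cancel₀ ht (by linear_combination e1) :
      2 * (n 0 * n 1 * n 2 * n 3) * (s0 n * sC n * sD n * sE n)
        = 2 * (m' 0 * m' 1 * m' 2 * m' 3) * (s0 n * sC n * sD n * sE n))
    exact mul_left_cancel₀ two_ne_zero this
  obtain ⟨j, t, ht, h⟩ := exists_smul_heisSign hsq hprod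
  refine ⟨(i, j), t, ht, funext fun k => ?_⟩
  rw [h, Pi.smul_apply, hheis, smul_eq_mul]

/-- The sixteen translates of a node are all the singular points. -/
theorem IsSingularPoint.exists_heis [IsAlgClosed L] {q : Fin 5 → L} {n m : Fin 4 → L}
    (hn : IsSingularPoint q n) (hm : IsSingularPoint q m) (hq : OffSingularHyperplanes q) :
    ∃ (g : Fin 4 × Fin 4) (t : L), t ≠ 0 ∧ n = t • HeisenbergQuartic.heis g m := by
  have on := hn.offFundamentalQuadrics hq
  have om := hm.offFundamentalQuadrics hq
  obtain ⟨t, ht⟩ := IsAlgClosed.exists_pow_nat_eq (s0 m / s0 n) two_pos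
  have ht0 : t ≠ 0 := by
    rintro rfl
    have := div_ne_zero om.s0 on.s0
    simp_all
  have hs : s0 (t • n) = s0 m := by
    rw [s0_smul, ht, div_mul_cancel₀ _ on.s0]
  obtain ⟨g, r, hr, h⟩ := (hn.smul ht0).exists_heis_of_s0_eq hm hq hs
  refine ⟨g, t⁻¹ * r, mul_ne_zero (inv_ne_zero ht0) hr, ?_⟩
  rw [mul_smul, ← h, inv_smul_smul₀ ht0]

end Classification

/-! ### The 32 conics and their ideals. -/

section Conics

variable {L : Type*} [Field L]

/-- The coefficients of the quadratic form `Q₁ + ρ Q'`, where `Q'` is the diagonal quadric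
attached to the node `n`. -/
def conicCoeff (n : Fin 4 → L) (ρ : L) : Fin 4 → L := ![1, -1, -1, 1] + ρ • tropeCoeff n

/-- The ideal of the conic cut out by `Q₁ + ρ Q'` on the plane dual to the node `n`. -/
noncomputable def conicIdeal (n : Fin 4 → L) (ρ : L) : Ideal (MvPolynomial (Fin 4) L) :=
  Ideal.span {dualPlane n, diagQuadric (conicCoeff n ρ)}

theorem diagQuadric_conicCoeff (n : Fin 4 → L) (ρ : L) :
    diagQuadric (conicCoeff n ρ) = quadric1 L + C ρ * tropeQuadric n := by
  simp only [diagQuadric, conicCoeff, quadric1, tropeQuadric, Fin.sum_univ_four, Pi.add_apply,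
    Pi.smul_apply, smul_eq_mul, Matrix.cons_val, map_add, map_mul, map_one, map_neg]
  ring

theorem dualPlane_smul (t : L) (n : Fin 4 → L) : dualPlane (t • n) = C t * dualPlane n := by
  simp only [dualPlane, Pi.smul_apply, smul_eq_mul, map_mul, Finset.mul_sum, mul_assoc]

theorem tropeCoeff_smul (t : L) (n : Fin 4 → L) :
    tropeCoeff (t • n) = t ^ 6 • tropeCoeff n := by
  ext i
  fin_cases i <;> simp only [tropeCoeff, Pi.smul_apply, smul_eq_mul, Matrix.cons_val,
    Fin.zero_eta, Fin.mk_one, Fin.reduceFinMk] <;> ring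

theorem conicIdeal_smul {t : L} (ht : t ≠ 0) (n : Fin 4 → L) (ρ : L) :
    conicIdeal (t • n) ρ = conicIdeal n (ρ * t ^ 6) := by
  rw [conicIdeal, conicIdeal, dualPlane_smul, conicCoeff, conicCoeff, tropeCoeff_smul, smul_smul,
    Ideal.span_insert, Ideal.span_insert,
    Ideal.span_singleton_mul_left_unit ((isUnit_iff_ne_zero.2 ht).map C)]

theorem eval_diagQuadric (c v : Fin 4 → L) :
    eval v (diagQuadric c) = ∑ i, c i * v i ^ 2 := by
  simp [diagQuadric]

theorem eval_dualPlane (n v : Fin 4 → L) : eval v (dualPlane n) = ∑ i, n i * v i := by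
  simp [dualPlane]

/-- The plane of a conic is determined by its ideal. -/
theorem exists_eq_smul_of_dualPlane_mem {n m : Fin 4 → L} {ρ : L}
    (h : dualPlane m ∈ conicIdeal n ρ) : ∃ t : L, m = t • n := by
  obtain ⟨f, g, e⟩ := Ideal.mem_span_pair.1 h
  refine ⟨eval 0 f, funext fun i => ?_⟩
  -- Derivatives at the origin see only the linear part, to which the quadric contributes nothing.
  have key := congrArg (fun F => eval 0 (pderiv i F)) e
  have hp (n : Fin 4 → L) : pderiv i (dualPlane n) = C (n i) := by
    simp [dualPlane, Derivation.leibniz, pderiv_X, Pi.single_apply]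
  have hQ : eval 0 (pderiv i (diagQuadric (conicCoeff n ρ))) = 0 := by
    simp [diagQuadric, Derivation.leibniz, Derivation.leibniz_pow]
  simp only [map_add, Derivation.leibniz, hp, smul_eq_mul, map_mul, hQ, eval_diagQuadric,
    eval_dualPlane, eval_C] at key
  simpa using key.symm

/-- Restrict to the line spanned by a vector `v` of the plane: the linear form dies and each quadric
becomes its value at `v` times `X ^ 2`. Comparing coefficients of `X ^ 2` gives a ratio `g(0)`
independent of `v`. -/
theorem exists_eval_eq_of_diagQuadric_mem {n c c' : Fin 4 → L}
    (h : diagQuadric c' ∈ Ideal.span {dualPlane n, diagQuadric c}) :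
    ∃ r : L, ∀ v : Fin 4 → L, ∑ i, n i * v i = 0 →
      ∑ i, c' i * v i ^ 2 = r * ∑ i, c i * v i ^ 2 := by
  obtain ⟨f, g, e⟩ := Ideal.mem_span_pair.1 h
  refine ⟨eval 0 g, fun v hv => ?_⟩
  let φ : MvPolynomial (Fin 4) L →ₐ[L] Polynomial L :=
    aeval fun i => Polynomial.C (v i) * Polynomial.X
  have hd (c : Fin 4 → L) : φ (diagQuadric c)
      = Polynomial.C (∑ i, c i * v i ^ 2) * Polynomial.X ^ 2 := by
    simp only [φ, diagQuadric, map_sum, map_mul, map_pow, aeval_X, algHom_C,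
      Polynomial.algebraMap_eq, mul_pow, Finset.sum_mul, mul_assoc]
  have hT : φ (dualPlane n) = 0 := by
    have : φ (dualPlane n) = Polynomial.C (∑ i, n i * v i) * Polynomial.X := by
      simp only [φ, dualPlane, map_sum, map_mul, aeval_X, algHom_C,
        Polynomial.algebraMap_eq, Finset.sum_mul, mul_assoc]
    rw [this, hv, map_zero, zero_mul]
  have key := congrArg φ e
  rw [map_add, map_mul, map_mul, hT, hd, hd, mul_zero, zero_add, ← mul_assoc] at key
  have key' := congrArg (Polynomial.eval 0)
    (mul_right_cancel₀ (pow_ne_zero 2 Polynomial.X_ne_zero) key)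
  have h0 : Polynomial.eval 0 (φ g) = eval 0 g := by
    have : (Polynomial.evalRingHom 0).comp φ.toRingHom = eval (0 : Fin 4 → L) := by
      ext i <;> simp [φ]
    exact congrArg (fun F => F g) this
  rw [Polynomial.eval_mul, h0, Polynomial.eval_C, Polynomial.eval_C] at key'
  exact key'.symm

/-- The quadric of a conic is determined by its ideal. -/
theorem eq_of_diagQuadric_mem [CharZero L] {n : Fin 4 → L} (hn : OffFundamentalQuadrics n)
    {ρ ρ' : L} (h : diagQuadric (conicCoeff n ρ') ∈ conicIdeal n ρ) : ρ' = ρ := by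
  obtain ⟨r, hr⟩ := exists_eval_eq_of_diagQuadric_mem h
  -- Both test vectors lie on the plane. The trope quadric vanishes at the first, where `Q₁ = -sE
  -- n`, so `r = 1`; at the second it equals `-2 * uD * vD * uE * vE`, which is nonzero.
  have h1 := hr ![n 1, -n 0, n 3, -n 2] (by simp [Fin.sum_univ_four]; ring)
  have h2 := hr ![0, 0, n 3, -n 2] (by simp [Fin.sum_univ_four]; ring)
  simp only [Fin.sum_univ_four, conicCoeff, tropeCoeff, Pi.add_apply, Pi.smul_apply, smul_eq_mul,
    Matrix.cons_val] at h1 h2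
  have hr1 : r = 1 := by
    refine mul_right_cancel₀ hn.sE ?_
    simp only [sE]
    linear_combination h1
  rw [hr1] at h2
  have hP : 2 * (uD n * vD n * (uE n * vE n)) ≠ 0 :=
    mul_ne_zero two_ne_zero (mul_ne_zero (mul_ne_zero hn.uD hn.vD) (mul_ne_zero hn.uE hn.vE))
  refine mul_right_cancel₀ hP ?_
  simp only [uD, vD, uE, vE]
  linear_combination -h2

theorem prime_dualPlane {n : Fin 4 → L} (hn : n ≠ 0) : Prime (dualPlane n) := by
  have h : dualPlane n = sumSMulX (Finsupp.equivFunOnFinite.symm n) := by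
    rw [sumSMulX, Finsupp.linearCombination_apply, Finsupp.sum_fintype _ _ (by simp)]
    simp [dualPlane, smul_eq_C_mul]
  obtain ⟨i, hi⟩ := Function.ne_iff.1 hn
  rw [h]
  refine (irreducible_sumSMulX _ ⟨i, by simpa using hi⟩ fun r hr => ?_).prime
  refine isUnit_iff_ne_zero.2 ?_
  rintro rfl
  exact hi (by simpa using hr i)

theorem span_pair_congr {R : Type*} [CommRing R] {x a b : R} (h : x ∣ a - b) :
    Ideal.span {x, a} = Ideal.span {x, b} := by
  obtain ⟨c, hc⟩ := h
  rw [show a = b + c * x by linear_combination hc,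
    Ideal.span_pair_add_mul_left]

/-- The associated conics lie on the surface. -/
theorem quartic_mem_of_mem_associatedConics {p : Fin 5 → L} (hΔ : segre p ≠ 0) (hβ : beta p ≠ 0)
    {I : Ideal (MvPolynomial (Fin 4) L)} (hI : I ∈ associatedConics p) : quartic p ∈ I := by
  obtain ⟨n, Q, l, μ, ρ, -, -, hQ, hρ, rfl⟩ := hI
  have hμ : segre p * ρ ^ 2 = - μ := by rw [hρ]; field_simp
  have hμ' : C (segre p) * C ρ ^ 2 = (-C μ : MvPolynomial (Fin 4) L) := by
    rw [← C_pow, ← C_mul, hμ, C_neg]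
  have hu : IsUnit (C (beta p) : MvPolynomial (Fin 4) L) := (isUnit_iff_ne_zero.2 hβ).map C
  rw [← Ideal.unit_mul_mem_iff_mem _ hu, quartic_pencil, hQ]
  refine Ideal.mem_span_pair.2 ⟨l, C (segre p) * (quadric1 L - C ρ * Q), ?_⟩
  linear_combination -Q ^ 2 * hμ'

variable [CharZero L]

/-- The data `Q', μ, l` in the definition are not unique. Modulo the prime `dualPlane n`, however,
`C ρ * Q'` and a multiple of `tropeQuadric n` have equal squares, so they agree up to sign, and
multiples of `dualPlane n` do not affect the ideal. -/
theorem mem_associatedConics [IsAlgClosed L] {p : Fin 5 → L} (hΔ : segre p ≠ 0)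
    (hq : OffSingularHyperplanes (thirdPoint p)) {I : Ideal (MvPolynomial (Fin 4) L)} :
    I ∈ associatedConics p ↔ ∃ (n : Fin 4 → L) (t ρ : L), IsSingularPoint (thirdPoint p) n ∧
      thirdPoint p = t • kummer n ∧ 4 * segre p * ρ ^ 2 = t ∧ I = conicIdeal n ρ := by
  have h4 : C (4 : L) * C (4⁻¹ : L) = (1 : MvPolynomial (Fin 4) L) := by
    rw [← C_mul, mul_inv_cancel₀ (by norm_num), C_1]
  have h4' : (4 : MvPolynomial (Fin 4) L) = C 4 := (map_ofNat C 4).symm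
  constructor
  · rintro ⟨n, Q, l, μ, ρ, hn, -, hQ, hρ, rfl⟩
    obtain ⟨t, -, ht⟩ := hn.exists_eq_smul_kummer hq
    obtain ⟨l', hl'⟩ := quartic_kummer n
    have key : C (4 * segre p) * (C ρ * Q) ^ 2 =
        C t * tropeQuadric n ^ 2 + (4 * l - C t * l') * dualPlane n := by
      have hμ : segre p * ρ ^ 2 = - μ := by rw [hρ]; field_simp
      have hμ' : C (segre p) * C ρ ^ 2 = (-C μ : MvPolynomial (Fin 4) L) := by
        rw [← C_pow, ← C_mul, hμ, C_neg]
      rw [ht, quartic_smul] at hQ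
      rw [C_mul, ← h4']
      linear_combination 4 * Q ^ 2 * hμ' + 4 * hQ - C t * hl'
    obtain ⟨r, hr⟩ := IsAlgClosed.exists_pow_nat_eq (t / (4 * segre p)) two_pos
    have h4Δ : 4 * segre p ≠ 0 := mul_ne_zero (by norm_num) hΔ
    have hr' : 4 * segre p * r ^ 2 = t := by rw [hr]; field_simp
    have hdvd : dualPlane n ∣ C (4 * segre p) *
        ((C ρ * Q - C r * tropeQuadric n) * (C ρ * Q + C r * tropeQuadric n)) := by
      refine ⟨4 * l - C t * l', ?_⟩
      rw [← hr', C_mul (a := 4 * segre p), C_pow] at key ⊢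
      linear_combination key
    have hT := prime_dualPlane hn.1
    rw [((isUnit_iff_ne_zero.2 h4Δ).map C).dvd_mul_left, hT.dvd_mul] at hdvd
    rcases hdvd with hd | hd
    · refine ⟨n, t, r, hn, ht, hr', ?_⟩
      rw [conicIdeal, diagQuadric_conicCoeff]
      exact span_pair_congr (by rwa [add_sub_add_left_eq_sub])
    · refine ⟨n, t, -r, hn, ht, by rw [neg_sq, hr'], ?_⟩
      rw [conicIdeal, diagQuadric_conicCoeff]
      refine span_pair_congr ?_
      rwa [add_sub_add_left_eq_sub, C_neg, neg_mul, sub_neg_eq_add]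
  · rintro ⟨n, t, ρ, hn, ht, hρ, rfl⟩
    obtain ⟨l, hl⟩ := quartic_kummer n
    refine ⟨n, tropeQuadric n, C (t / 4) * l, -t / 4, ρ, hn, ?_, ?_, ?_, ?_⟩
    · refine IsHomogeneous.sum _ _ _ fun i _ => ?_
      exact (isHomogeneous_C_mul_X_pow _ _ _)
    · rw [ht, quartic_smul, div_eq_mul_inv, div_eq_mul_inv, C_mul, C_mul, C_neg]
      rw [h4'] at hl
      linear_combination C t * C 4⁻¹ * hl - C t * quartic (kummer n) * h4
    · field_simp
      linear_combination hρ
    · rw [conicIdeal, diagQuadric_conicCoeff]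

theorem mem_associatedConics_iff [IsAlgClosed L] {p : Fin 5 → L} (hΔ : segre p ≠ 0)
    (hq : OffSingularHyperplanes (thirdPoint p)) {n : Fin 4 → L} {t r : L}
    (hn : IsSingularPoint (thirdPoint p) n) (ht : thirdPoint p = t • kummer n)
    (hr : 4 * segre p * r ^ 2 = t) {I : Ideal (MvPolynomial (Fin 4) L)} :
    I ∈ associatedConics p ↔
      ∃ (g : Fin 4 × Fin 4) (s : Bool), conicIdeal (heis g n) (cond s r (-r)) = I := by
  have h4Δ : 4 * segre p ≠ 0 := mul_ne_zero (by norm_num) hΔ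
  rw [mem_associatedConics hΔ hq]
  constructor
  · rintro ⟨m, t', ρ, hm, ht', hρ, rfl⟩
    obtain ⟨g, c, hc, rfl⟩ := hm.exists_heis hn hq
    refine ⟨g, ?_⟩
    have hk : kummer n ≠ 0 := by
      intro h
      apply hq.1
      rw [ht, h]
      simp
    have htt : t = t' * c ^ 12 := by
      rw [ht', kummer_smul, kummer_heis, smul_smul] at ht
      exact (smul_left_injective L hk ht).symm
    -- Rescaling a node by `c` multiplies `kummer` by `c ^ 12` and the trope quadric by `c ^ 6`, so
    -- `ρ * c ^ 6` has a fixed square.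
    have : (ρ * c ^ 6) ^ 2 = r ^ 2 := by
      refine mul_left_cancel₀ h4Δ ?_
      rw [hr, htt, ← hρ]
      ring
    rw [conicIdeal_smul hc]
    rcases sq_eq_sq_iff_eq_or_eq_neg.1 this with h | h
    · exact ⟨true, by rw [h, cond_true]⟩
    · exact ⟨false, by rw [h, cond_false]⟩
  · rintro ⟨g, s, rfl⟩
    refine ⟨heis g n, t, cond s r (-r), hn.heis hq g, by rw [kummer_heis, ht], ?_, rfl⟩
    cases s <;> simp [hr]

theorem ncard_associatedConics [IsAlgClosed L] {p : Fin 5 → L} (hΔ : segre p ≠ 0)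
    (hq : OffSingularHyperplanes (thirdPoint p)) : (associatedConics p).ncard = 32 := by
  obtain ⟨n, hn⟩ := exists_singularPoint hq (segre_thirdPoint p)
  obtain ⟨t, ht0, ht⟩ := hn.exists_eq_smul_kummer hq
  have h4Δ : 4 * segre p ≠ 0 := mul_ne_zero (by norm_num) hΔ
  obtain ⟨r, hr⟩ := IsAlgClosed.exists_pow_nat_eq (t / (4 * segre p)) two_pos
  have hr0 : r ≠ 0 := by
    rintro rfl
    have := div_ne_zero ht0 h4Δ
    simp_all
  have hr' : 4 * segre p * r ^ 2 = t := by rw [hr]; field_simp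
  let f : (Fin 4 × Fin 4) × Bool → Ideal (MvPolynomial (Fin 4) L) :=
    fun x => conicIdeal (heis x.1 n) (cond x.2 r (-r))
  -- The ideal determines its plane, hence `g`, and then its quadric modulo that plane, hence the
  -- sign of `r`.
  have hf : Function.Injective f := by
    rintro ⟨g, s⟩ ⟨g', s'⟩ h
    replace h : conicIdeal (heis g n) (cond s r (-r)) = conicIdeal (heis g' n) (cond s' r (-r)) := h
    have hmem : dualPlane (heis g n) ∈ conicIdeal (heis g' n) (cond s' r (-r)) :=
      h ▸ Ideal.subset_span (by simp)
    obtain ⟨c, hc⟩ := exists_eq_smul_of_dualPlane_mem hmem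
    obtain rfl := heis_injective (hn.offFundamentalQuadrics hq) hc
    have hmem : diagQuadric (conicCoeff (heis g n) (cond s r (-r)))
        ∈ conicIdeal (heis g n) (cond s' r (-r)) := h ▸ Ideal.subset_span (by simp)
    have := eq_of_diagQuadric_mem ((hn.heis hq g).offFundamentalQuadrics hq) hmem
    have hne : r ≠ -r := self_ne_neg.2 hr0
    cases s <;> cases s' <;> first | rfl | exact (hne this).elim | exact (hne this.symm).elim
  have : associatedConics p = Set.range f := by
    ext I
    rw [mem_associatedConics_iff hΔ hq hn ht hr']
    simp [f]
  rw [this, ← Set.image_univ, Set.ncard_image_of_injective _ hf, Set.ncard_univ]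
  simp

end Conics

/-! ### The radicands of `M` at a node. -/

section Radicands

variable {L : Type*} [Field L]

/-- The radicands defining `M` in terms of a node of the Kummer surface. -/
theorem radicands_eq {p : Fin 5 → L} (hβ : beta p ≠ 0) {n : Fin 4 → L} {t : L}
    (ht : thirdPoint p = t • kummer n) :
    segre p * qPlusC p * pMinus0 p * pPlus1 p = segre p * t * (sD n * uD n * uE n) ^ 2 ∧
    segre p * qPlusC p * pPlus0 p * pMinus1 p = segre p * t * (sD n * vD n * vE n) ^ 2 ∧
    segre p * qPlusD p * pPlus0 p * pMinus2 p = segre p * t * (sC n * vC n * vE n) ^ 2 ∧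
    segre p * qPlusD p * pMinus0 p * pPlus2 p = segre p * t * (sC n * uC n * uE n) ^ 2 ∧
    -segre p * qMinusE p * pPlus1 p * pMinus2 p = segre p * t * (s0 n * vC n * uD n) ^ 2 := by
  -- Each radicand contains three linear forms, each needing a factor `beta p` to be moved to `p₁`.
  -- Dividing by `beta p ^ 3` in this form leaves `t` times a square.
  have hb : beta p ^ 3 = t ^ 2 * (4 * sE n ^ 2 * (s0 n * sC n * sD n * sE n * (uC n * vC n)
      * (uD n * vD n) * (uE n * vE n))) := by
    rw [← beta_thirdPoint, ht, beta_smul, beta_kummer]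
  have hb0 : beta p ^ 3 ≠ 0 := pow_ne_zero 3 hβ
  obtain ⟨eC, eD, eE, e0, e1, e2, e0', e1', e2'⟩ := hyperplanes_thirdPoint p
  rw [ht] at eC eD eE e0 e1 e2 e0' e1' e2'
  have fC : beta p * qPlusC p = t * qPlusC (kummer n) := by
    rw [← eC]; simp only [qPlusC, Pi.smul_apply, smul_eq_mul]; ring
  have fD : beta p * qPlusD p = t * qPlusD (kummer n) := by
    rw [← eD]; simp only [qPlusD, Pi.smul_apply, smul_eq_mul]; ring
  have fE : beta p * qMinusE p = t * qMinusE (kummer n) := by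
    rw [← eE]; simp only [qMinusE, Pi.smul_apply, smul_eq_mul]; ring
  have f0 : beta p * pPlus0 p = t * pPlus0 (kummer n) := by
    rw [← e0]; simp only [pPlus0, Pi.smul_apply, smul_eq_mul]; ring
  have f1 : beta p * pPlus1 p = t * pPlus1 (kummer n) := by
    rw [← e1]; simp only [pPlus1, Pi.smul_apply, smul_eq_mul]; ring
  have f2 : beta p * pPlus2 p = t * pPlus2 (kummer n) := by
    rw [← e2]; simp only [pPlus2, Pi.smul_apply, smul_eq_mul]; ring
  have f0' : beta p * pMinus0 p = t * pMinus0 (kummer n) := by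
    rw [← e0']; simp only [pMinus0, Pi.smul_apply, smul_eq_mul]; ring
  have f1' : beta p * pMinus1 p = t * pMinus1 (kummer n) := by
    rw [← e1']; simp only [pMinus1, Pi.smul_apply, smul_eq_mul]; ring
  have f2' : beta p * pMinus2 p = t * pMinus2 (kummer n) := by
    rw [← e2']; simp only [pMinus2, Pi.smul_apply, smul_eq_mul]; ring
  rw [qPlusC_kummer] at fC
  rw [qPlusD_kummer] at fD
  rw [qMinusE_kummer] at fE
  rw [pPlus0_kummer] at f0
  rw [pPlus1_kummer] at f1
  rw [pPlus2_kummer] at f2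
  rw [pMinus0_kummer] at f0'
  rw [pMinus1_kummer] at f1'
  rw [pMinus2_kummer] at f2'
  refine ⟨?_, ?_, ?_, ?_, ?_⟩ <;> refine mul_left_cancel₀ hb0 ?_
  · calc _ = segre p * (beta p * qPlusC p) * (beta p * pMinus0 p) * (beta p * pPlus1 p) := by ring
      _ = _ := by rw [fC, f0', f1, hb]; ring
  · calc _ = segre p * (beta p * qPlusC p) * (beta p * pPlus0 p) * (beta p * pMinus1 p) := by ring
      _ = _ := by rw [fC, f0, f1', hb]; ring
  · calc _ = segre p * (beta p * qPlusD p) * (beta p * pPlus0 p) * (beta p * pMinus2 p) := by ring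
      _ = _ := by rw [fD, f0, f2', hb]; ring
  · calc _ = segre p * (beta p * qPlusD p) * (beta p * pMinus0 p) * (beta p * pPlus2 p) := by ring
      _ = _ := by rw [fD, f0', f2, hb]; ring
  · calc _ = -segre p * (beta p * qMinusE p) * (beta p * pPlus1 p) * (beta p * pMinus2 p) := by ring
      _ = _ := by rw [fE, f1, f2', hb]; ring

end Radicands

/-! ### Galois descent for the conics. -/

section FieldsOfDefinition

variable {K L : Type*} [Field K] [Field L] [Algebra K L]

theorem map_dualPlane {F : Type*} [Field F] (f : F →+* L) (n : Fin 4 → F) :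
    MvPolynomial.map f (dualPlane n) = dualPlane (f ∘ n) := by
  simp [dualPlane]

theorem map_diagQuadric {F : Type*} [Field F] (f : F →+* L) (n : Fin 4 → F) :
    MvPolynomial.map f (diagQuadric n) = diagQuadric (f ∘ n) := by
  simp [diagQuadric]

theorem comp_conicCoeff {F : Type*} [Field F] (f : F →+* L) (n : Fin 4 → F) (ρ : F) :
    f ∘ conicCoeff n ρ = conicCoeff (f ∘ n) (f ρ) := by
  ext i
  fin_cases i <;> simp [conicCoeff, tropeCoeff, map_ofNat]

theorem isDefinedOver_conicIdeal {F : IntermediateField K L} {n : Fin 4 → L} {ρ : L}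
    (hn : ∀ i, n i ∈ F) (hρ : ρ ∈ F) : IsDefinedOver F (conicIdeal n ρ) := by
  let m : Fin 4 → F := fun i => ⟨n i, hn i⟩
  have hm : algebraMap F L ∘ m = n := rfl
  refine ⟨{dualPlane m, diagQuadric (conicCoeff m ⟨ρ, hρ⟩)}, ?_⟩
  rw [Set.image_pair, map_dualPlane, map_diagQuadric, comp_conicCoeff, hm]
  rfl

theorem IsDefinedOver.map_mem {F : IntermediateField K L} {I : Ideal (MvPolynomial (Fin 4) L)}
    (h : IsDefinedOver F I) (σ : L ≃ₐ[F] L) {x : MvPolynomial (Fin 4) L} (hx : x ∈ I) :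
    MvPolynomial.map (σ : L →+* L) x ∈ I := by
  obtain ⟨S, rfl⟩ := h
  suffices Ideal.span (MvPolynomial.map (algebraMap F L) '' S) ≤
      (Ideal.span (MvPolynomial.map (algebraMap F L) '' S)).comap
        (MvPolynomial.map (σ : L →+* L)) from this hx
  rw [Ideal.span_le]
  rintro _ ⟨s, hs, rfl⟩
  have : (σ : L →+* L).comp (algebraMap F L) = algebraMap F L := by
    ext a
    exact σ.commutes a
  rw [SetLike.mem_coe, Ideal.mem_comap, MvPolynomial.map_map, this]
  exact Ideal.subset_span ⟨s, hs, rfl⟩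

theorem mem_of_forall_fixed [IsGalois K L] (F : IntermediateField K L) {x : L}
    (h : ∀ σ : L ≃ₐ[F] L, σ x = x) : x ∈ F := by
  obtain ⟨y, rfl⟩ := (InfiniteGalois.mem_range_algebraMap_iff_fixed x).2 h
  exact y.2

/-- An automorphism over `F` preserves the ideal, so it sends the plane to a proportional one; the
coordinate equal to `1` makes the factor `1`. -/
theorem IsDefinedOver.coord_mem [IsGalois K L] {F : IntermediateField K L} {n : Fin 4 → L} {ρ : L}
    (h : IsDefinedOver F (conicIdeal n ρ)) {k : Fin 4} (hk : n k = 1) (i : Fin 4) : n i ∈ F := by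
  refine mem_of_forall_fixed F fun σ => ?_
  have hm : dualPlane n ∈ conicIdeal n ρ := Ideal.subset_span (by simp)
  have := h.map_mem σ hm
  rw [map_dualPlane] at this
  obtain ⟨c, hc⟩ := exists_eq_smul_of_dualPlane_mem this
  have hc1 : c = 1 := by
    have := congrFun hc k
    simpa [hk] using this.symm
  have := congrFun hc i
  simpa [hc1] using this

theorem IsDefinedOver.scalar_mem [IsGalois K L] [CharZero L] {F : IntermediateField K L}
    {n : Fin 4 → L} {ρ : L} (hn : OffFundamentalQuadrics n)
    (h : IsDefinedOver F (conicIdeal n ρ)) {k : Fin 4} (hk : n k = 1) : ρ ∈ F := by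
  refine mem_of_forall_fixed F fun σ => ?_
  have hm : diagQuadric (conicCoeff n ρ) ∈ conicIdeal n ρ := Ideal.subset_span (by simp)
  have := h.map_mem σ hm
  have hσ : (σ : L →+* L) ∘ n = n := by
    ext i
    exact σ.commutes ⟨n i, h.coord_mem hk i⟩
  rw [map_diagQuadric, comp_conicCoeff, hσ] at this
  exact eq_of_diagQuadric_mem hn this

theorem mem_of_mul_mem {F : IntermediateField K L} {x y : L} (hx : x ∈ F) (h0 : x ≠ 0)
    (h : x * y ∈ F) : y ∈ F := by
  rw [← inv_mul_cancel_left₀ h0 y]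
  exact mul_mem (inv_mem hx) h

/-- The ten fundamental quadrics take values in any field containing the coordinates. -/
theorem fundamentalQuadrics_mem {F : IntermediateField K L} {n : Fin 4 → L} (hn : ∀ i, n i ∈ F) :
    s0 n ∈ F ∧ sC n ∈ F ∧ sD n ∈ F ∧ uC n ∈ F ∧ vC n ∈ F ∧ uD n ∈ F ∧ vD n ∈ F ∧
      uE n ∈ F ∧ vE n ∈ F := by
  have h (i j) : n i * n j ∈ F := mul_mem (hn i) (hn j)
  simp only [s0, sC, sD, uC, vC, uD, vD, uE, vE, sq]
  exact ⟨add_mem (add_mem (add_mem (h _ _) (h _ _)) (h _ _)) (h _ _),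
    sub_mem (sub_mem (add_mem (h _ _) (h _ _)) (h _ _)) (h _ _),
    sub_mem (add_mem (sub_mem (h _ _) (h _ _)) (h _ _)) (h _ _),
    add_mem (h _ _) (h _ _), sub_mem (h _ _) (h _ _), add_mem (h _ _) (h _ _),
    sub_mem (h _ _) (h _ _), add_mem (h _ _) (h _ _), sub_mem (h _ _) (h _ _)⟩

theorem segre_coordsIn (p : Fin 5 → K) : segre (coordsIn L p) = algebraMap K L (segre p) := by
  simp [segre, coordsIn, map_ofNat]

theorem beta_coordsIn (p : Fin 5 → K) : beta (coordsIn L p) = algebraMap K L (beta p) := by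
  simp [beta, coordsIn, map_ofNat]

theorem thirdPoint_coordsIn (p : Fin 5 → K) (i : Fin 5) :
    thirdPoint (coordsIn L p) i = algebraMap K L (thirdPoint p i) := by
  simp only [thirdPoint, Pi.sub_apply, Pi.smul_apply, smul_eq_mul, segre_coordsIn, beta_coordsIn,
    map_sub, map_mul]
  fin_cases i <;> simp [coordsIn, node1, map_ofNat]

theorem offSingularHyperplanes_coordsIn {p : Fin 5 → K} (hp : OffSingularHyperplanes p) :
    OffSingularHyperplanes (coordsIn L p) := by
  have h (x : K) (hx : x ≠ 0) : algebraMap K L x ≠ 0 := (map_ne_zero _).2 hx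
  obtain ⟨h1, h2, h3, h4, h5, h6, h7, h8, h9, h10, h11, h12, h13, h14, h15⟩ := hp
  exact ⟨h _ h1,
    by simpa [qPlusC, coordsIn, map_ofNat] using h _ h2,
    by simpa [qMinusC, coordsIn, map_ofNat] using h _ h3,
    by simpa [qPlusD, coordsIn, map_ofNat] using h _ h4,
    by simpa [qMinusD, coordsIn, map_ofNat] using h _ h5,
    by simpa [qPlusE, coordsIn, map_ofNat] using h _ h6,
    by simpa [qMinusE, coordsIn, map_ofNat] using h _ h7,
    by simpa [pPlus0, coordsIn, map_ofNat] using h _ h8,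
    by simpa [pPlus1, coordsIn, map_ofNat] using h _ h9,
    by simpa [pPlus2, coordsIn, map_ofNat] using h _ h10,
    by simpa [pPlus3, coordsIn, map_ofNat] using h _ h11,
    by simpa [pMinus0, coordsIn, map_ofNat] using h _ h12,
    by simpa [pMinus1, coordsIn, map_ofNat] using h _ h13,
    by simpa [pMinus2, coordsIn, map_ofNat] using h _ h14,
    by simpa [pMinus3, coordsIn, map_ofNat] using h _ h15⟩

theorem sqrtField_eq_adjoin_radicands (p : Fin 5 → K) :
    let P := coordsIn L p
    sqrtField L p = IntermediateField.adjoin K {x : L |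
      x ^ 2 = segre P * qPlusC P * pMinus0 P * pPlus1 P ∨
      x ^ 2 = segre P * qPlusC P * pPlus0 P * pMinus1 P ∨
      x ^ 2 = segre P * qPlusD P * pPlus0 P * pMinus2 P ∨
      x ^ 2 = segre P * qPlusD P * pMinus0 P * pPlus2 P ∨
      x ^ 2 = -segre P * qMinusE P * pPlus1 P * pMinus2 P} := by
  simp only [sqrtField, segre_coordsIn, map_mul, map_neg]
  simp [qPlusC, qPlusD, qMinusE, pPlus0, pPlus1, pPlus2, pMinus0, pMinus1, pMinus2, coordsIn,
    map_ofNat]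

/-- The field `M` in terms of a node of the Kummer surface. -/
theorem sqrtField_eq {p : Fin 5 → K} (hβ : beta p ≠ 0) {n : Fin 4 → L} {t s : L}
    (ht : thirdPoint (coordsIn L p) = t • kummer n) (hs : s ^ 2 = segre (coordsIn L p) * t) :
    sqrtField L p = IntermediateField.adjoin K
      {s * (sD n * uD n * uE n), s * (sD n * vD n * vE n), s * (sC n * vC n * vE n),
        s * (sC n * uC n * uE n), s * (s0 n * vC n * uD n)} := by
  have hβ' : beta (coordsIn L p) ≠ 0 := by
    rw [beta_coordsIn]; exact (map_ne_zero _).2 hβ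
  obtain ⟨e1, e2, e3, e4, e5⟩ := radicands_eq hβ' ht
  simp only [sqrtField_eq_adjoin_radicands]
  rw [e1, e2, e3, e4, e5, ← hs]
  simp only [← mul_pow, sq_eq_sq_iff_eq_or_eq_neg]
  apply le_antisymm <;> rw [IntermediateField.adjoin_le_iff]
  · have key (y : L) (hy : y ∈ ({s * (sD n * uD n * uE n), s * (sD n * vD n * vE n),
        s * (sC n * vC n * vE n), s * (sC n * uC n * uE n), s * (s0 n * vC n * uD n)} : Set L))
        (x : L) (hx : x = y ∨ x = -y) : x ∈ IntermediateField.adjoin K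
      {s * (sD n * uD n * uE n), s * (sD n * vD n * vE n), s * (sC n * vC n * vE n),
        s * (sC n * uC n * uE n), s * (s0 n * vC n * uD n)} := by
      have := IntermediateField.subset_adjoin K _ hy
      rcases hx with rfl | rfl
      · exact this
      · exact neg_mem this
    rintro x (h | h | h | h | h) <;> exact key _ (by simp) x h
  · rintro x (rfl | rfl | rfl | rfl | rfl) <;> exact IntermediateField.subset_adjoin K _ (by simp)

end FieldsOfDefinition

/-! ### Comparison of `M`, the field of definition and `K₁`. -/

section SqrtField

variable {K L : Type*} [Field K] [Field L] [Algebra K L]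

theorem thirdPoint_mem (F : IntermediateField K L) (p : Fin 5 → K) (i : Fin 5) :
    thirdPoint (coordsIn L p) i ∈ F := by
  rw [thirdPoint_coordsIn]
  exact F.algebraMap_mem _

theorem segre_mem (F : IntermediateField K L) (p : Fin 5 → K) : segre (coordsIn L p) ∈ F := by
  rw [segre_coordsIn]
  exact F.algebraMap_mem _

theorem sq_root_eq {p : Fin 5 → L} {t ρ : L} (hρ : 4 * segre p * ρ ^ 2 = t) :
    (2 * segre p * ρ) ^ 2 = segre p * t := by
  linear_combination segre p * hρ

theorem sqrtField_le {p : Fin 5 → K} (hβ : beta p ≠ 0) {n : Fin 4 → L} {t ρ : L}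
    (ht : thirdPoint (coordsIn L p) = t • kummer n)
    (hρ : 4 * segre (coordsIn L p) * ρ ^ 2 = t) {F : IntermediateField K L} (hn : ∀ i, n i ∈ F)
    (hρF : ρ ∈ F) : sqrtField L p ≤ F := by
  rw [sqrtField_eq hβ ht (sq_root_eq hρ), IntermediateField.adjoin_le_iff]
  obtain ⟨h0, hC, hD, huC, hvC, huD, hvD, huE, hvE⟩ := fundamentalQuadrics_mem hn
  have hs : 2 * segre (coordsIn L p) * ρ ∈ F := mul_mem (mul_mem (ofNat_mem _ 2) (segre_mem _ p)) hρF
  rintro x (rfl | rfl | rfl | rfl | rfl)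
  · exact mul_mem hs (mul_mem (mul_mem hD huD) huE)
  · exact mul_mem hs (mul_mem (mul_mem hD hvD) hvE)
  · exact mul_mem hs (mul_mem (mul_mem hC hvC) hvE)
  · exact mul_mem hs (mul_mem (mul_mem hC huC) huE)
  · exact mul_mem hs (mul_mem (mul_mem h0 hvC) huD)

variable [CharZero L]

/-- The products of the coordinates of a suitably normalised node lie in `M`. -/
theorem mul_mem_sqrtField {p : Fin 5 → K} (hΔ : segre p ≠ 0) (hβ : beta p ≠ 0) [IsAlgClosed L]
    (hq : OffSingularHyperplanes (thirdPoint (coordsIn L p))) {m : Fin 4 → L} {t : L} (ht0 : t ≠ 0)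
    (hm : OffFundamentalQuadrics m) (ht : thirdPoint (coordsIn L p) = t • kummer m)
    (h1 : sE m = 1) (i j : Fin 4) : m i * m j ∈ sqrtField L p := by
  obtain ⟨s, hs⟩ := IsAlgClosed.exists_pow_nat_eq (segre (coordsIn L p) * t) two_pos
  have hM := sqrtField_eq hβ ht hs
  have hΔM := segre_mem (sqrtField L p) p
  have hqM := thirdPoint_mem (sqrtField L p) p
  have hΔL : segre (coordsIn L p) ≠ 0 := by
    rw [segre_coordsIn]; exact (map_ne_zero _).2 hΔ
  generalize hF : sqrtField L p = F at hM hΔM hqM ⊢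
  generalize hδ : segre (coordsIn L p) = δ at hs hΔM hΔL
  have g1 : s * (sD m * uD m * uE m) ∈ F := hM ▸ IntermediateField.subset_adjoin K _ (by simp)
  have g2 : s * (sD m * vD m * vE m) ∈ F := hM ▸ IntermediateField.subset_adjoin K _ (by simp)
  have g3 : s * (sC m * vC m * vE m) ∈ F := hM ▸ IntermediateField.subset_adjoin K _ (by simp)
  have g4 : s * (sC m * uC m * uE m) ∈ F := hM ▸ IntermediateField.subset_adjoin K _ (by simp)
  have g5 : s * (s0 m * vC m * uD m) ∈ F := hM ▸ IntermediateField.subset_adjoin K _ (by simp)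
  clear hM hF
  generalize hQ : thirdPoint (coordsIn L p) = q at ht hqM hq
  have m2 : (2 : L) ∈ F := ofNat_mem F 2
  have m4 : (4 : L) ∈ F := ofNat_mem F 4
  obtain ⟨-, hC, -, hD, -⟩ := hq
  have mC : qPlusC q ∈ F := add_mem (mul_mem m2 (hqM 0)) (hqM 2)
  have mC' : qMinusC q ∈ F := sub_mem (mul_mem m2 (hqM 0)) (hqM 2)
  have mD : qPlusD q ∈ F := add_mem (mul_mem m2 (hqM 0)) (hqM 3)
  have eC : qPlusC q = t * qPlusC (kummer m) := by
    rw [ht]; simp only [qPlusC, Pi.smul_apply, smul_eq_mul]; ring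
  have eC' : qMinusC q = t * qMinusC (kummer m) := by
    rw [ht]; simp only [qMinusC, Pi.smul_apply, smul_eq_mul]; ring
  have eD : qPlusD q = t * qPlusD (kummer m) := by
    rw [ht]; simp only [qPlusD, Pi.smul_apply, smul_eq_mul]; ring
  rw [qPlusC_kummer, h1] at eC
  rw [qMinusC_kummer] at eC'
  rw [qPlusD_kummer, h1] at eD
  have e0 : q 0 = t * kummer m 0 := by rw [ht]; rfl
  have e1 : q 1 = t * kummer m 1 := by rw [ht]; rfl
  simp only [kummer, Matrix.cons_val, h1] at e0 e1
  obtain ⟨hs0, hsC, hsD, -, huC, hvC, huD, hvD, huE, hvE⟩ := hm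
  -- As `sE m = 1`, the product of the first two generators is `-δ * qPlusC q * sD m`. The third and
  -- fourth give `sC m` in the same way, and the first node relation gives `s0 m`.
  have kD : sD m ∈ F := by
    refine mem_of_mul_mem (mul_mem hΔM mC) (mul_ne_zero hΔL hC) ?_
    rw [show δ * qPlusC q * sD m = -(s * (sD m * uD m * uE m) * (s * (sD m * vD m * vE m))) by
      rw [eC]
      linear_combination sD m ^ 2 * uD m * uE m * vD m * vE m * hs]
    exact neg_mem (mul_mem g1 g2)
  have kC : sC m ∈ F := by
    refine mem_of_mul_mem (mul_mem hΔM mD) (mul_ne_zero hΔL hD) ?_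
    rw [show δ * qPlusD q * sC m = -(s * (sC m * vC m * vE m) * (s * (sC m * uC m * uE m))) by
      rw [eD]
      linear_combination sC m ^ 2 * uC m * uE m * vC m * vE m * hs]
    exact neg_mem (mul_mem g3 g4)
  have k0 : s0 m ∈ F := by
    refine mem_of_mul_mem (mul_mem mC kC) (mul_ne_zero hC hsC) ?_
    rw [show qPlusC q * sC m * s0 m = -(qMinusC q * sD m) by rw [eC, eC']; ring]
    exact neg_mem (mul_mem mC' kD)
  have kE : sE m ∈ F := h1 ▸ one_mem F
  have half {x : L} (h : 2 * x ∈ F) : x ∈ F := mem_of_mul_mem m2 two_ne_zero h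
  have quarter {x : L} (h : 4 * x ∈ F) : x ∈ F := mem_of_mul_mem m4 (by norm_num) h
  have f0 : m 0 ^ 2 ∈ F := quarter (by
    rw [show 4 * m 0 ^ 2 = s0 m + sC m + sD m + sE m by simp only [s0, sC, sD, sE]; ring]
    exact add_mem (add_mem (add_mem k0 kC) kD) kE)
  have f1 : m 1 ^ 2 ∈ F := quarter (by
    rw [show 4 * m 1 ^ 2 = s0 m + sC m - sD m - sE m by simp only [s0, sC, sD, sE]; ring]
    exact sub_mem (sub_mem (add_mem k0 kC) kD) kE)
  have f2 : m 2 ^ 2 ∈ F := quarter (by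
    rw [show 4 * m 2 ^ 2 = s0 m - sC m + sD m - sE m by simp only [s0, sC, sD, sE]; ring]
    exact sub_mem (add_mem (sub_mem k0 kC) kD) kE)
  have f3 : m 3 ^ 2 ∈ F := quarter (by
    rw [show 4 * m 3 ^ 2 = s0 m - sC m - sD m + sE m by simp only [s0, sC, sD, sE]; ring]
    exact add_mem (sub_mem (sub_mem k0 kC) kD) kE)
  have pC : uC m * vC m ∈ F := by
    rw [show uC m * vC m = m 0 ^ 2 * m 1 ^ 2 - m 2 ^ 2 * m 3 ^ 2 by simp only [uC, vC]; ring]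
    exact sub_mem (mul_mem f0 f1) (mul_mem f2 f3)
  have pD : uD m * vD m ∈ F := by
    rw [show uD m * vD m = m 0 ^ 2 * m 2 ^ 2 - m 1 ^ 2 * m 3 ^ 2 by simp only [uD, vD]; ring]
    exact sub_mem (mul_mem f0 f2) (mul_mem f1 f3)
  have pE : uE m * vE m ∈ F := by
    rw [show uE m * vE m = m 0 ^ 2 * m 3 ^ 2 - m 1 ^ 2 * m 2 ^ 2 by simp only [uE, vE]; ring]
    exact sub_mem (mul_mem f0 f3) (mul_mem f1 f2)
  have nC := mul_ne_zero huC hvC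
  have nD := mul_ne_zero huD hvD
  have nE := mul_ne_zero huE hvE
  have kt : t ∈ F := by
    refine mem_of_mul_mem (mul_mem (mul_mem pC pD) pE) (mul_ne_zero (mul_ne_zero nC nD) nE) ?_
    rw [mul_comm, ← e0]
    exact hqM 0
  -- The parameter `B` of `p₁` gives the product of the coordinates, whose squares are already
  -- known.
  have kabcd : m 0 * m 1 * m 2 * m 3 ∈ F := by
    refine half (mem_of_mul_mem (mul_mem kt (mul_mem (mul_mem k0 kC) kD))
      (mul_ne_zero ht0 (mul_ne_zero (mul_ne_zero hs0 hsC) hsD)) ?_)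
    rw [show t * (s0 m * sC m * sD m) * (2 * (m 0 * m 1 * m 2 * m 3)) = q 1 by rw [e1]; ring]
    exact hqM 1
  have sqD : uD m ^ 2 ∈ F := by
    rw [show uD m ^ 2 = m 0 ^ 2 * m 2 ^ 2 + m 1 ^ 2 * m 3 ^ 2 + 2 * (m 0 * m 1 * m 2 * m 3) by
      simp only [uD]; ring]
    exact add_mem (add_mem (mul_mem f0 f2) (mul_mem f1 f3)) (mul_mem m2 kabcd)
  have sqC : vC m ^ 2 ∈ F := by
    rw [show vC m ^ 2 = m 0 ^ 2 * m 1 ^ 2 + m 2 ^ 2 * m 3 ^ 2 - 2 * (m 0 * m 1 * m 2 * m 3) by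
      simp only [vC]; ring]
    exact sub_mem (add_mem (mul_mem f0 f1) (mul_mem f2 f3)) (mul_mem m2 kabcd)
  have kDC : uD m * vC m ∈ F := by
    refine mem_of_mul_mem (mul_mem (mul_mem hΔM kt) (mul_mem (mul_mem kD kC) pE))
      (mul_ne_zero (mul_ne_zero hΔL ht0) (mul_ne_zero (mul_ne_zero hsD hsC) nE)) ?_
    rw [← hs, show s ^ 2 * (sD m * sC m * (uE m * vE m)) * (uD m * vC m)
      = s * (sD m * uD m * uE m) * (s * (sC m * vC m * vE m)) by ring]
    exact mul_mem g1 g3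
  have kEC : uE m * vC m ∈ F := by
    refine mem_of_mul_mem (mul_mem (mul_mem hΔM kt) (mul_mem (mul_mem kD k0) sqD))
      (mul_ne_zero (mul_ne_zero hΔL ht0) (mul_ne_zero (mul_ne_zero hsD hs0) (pow_ne_zero 2 huD))) ?_
    rw [← hs, show s ^ 2 * (sD m * s0 m * uD m ^ 2) * (uE m * vC m)
      = s * (sD m * uD m * uE m) * (s * (s0 m * vC m * uD m)) by ring]
    exact mul_mem g1 g5
  have kDE : uD m * uE m ∈ F := by
    refine mem_of_mul_mem sqC (pow_ne_zero 2 hvC) ?_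
    rw [show vC m ^ 2 * (uD m * uE m) = uD m * vC m * (uE m * vC m) by ring]
    exact mul_mem kDC kEC
  -- So far only products of two of the `u`, `v` are known to lie in `F`. The identity `2 * uD * uE
  -- = s0 * uC - sC * vC`, multiplied by `vC`, isolates a single one.
  have kvC : vC m ∈ F := by
    refine mem_of_mul_mem (mul_mem m2 kDE) (mul_ne_zero two_ne_zero (mul_ne_zero huD huE)) ?_
    rw [show 2 * (uD m * uE m) * vC m = s0 m * (uC m * vC m) - sC m * vC m ^ 2 by
      simp only [uC, vC, uD, uE, s0, sC]; ring]
    exact sub_mem (mul_mem k0 pC) (mul_mem kC sqC)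
  have kuC : uC m ∈ F := mem_of_mul_mem kvC hvC (by rwa [mul_comm])
  have kuD : uD m ∈ F := mem_of_mul_mem kvC hvC (by rwa [mul_comm])
  have kuE : uE m ∈ F := mem_of_mul_mem kvC hvC (by rwa [mul_comm])
  have kvD : vD m ∈ F := mem_of_mul_mem kuD huD pD
  have kvE : vE m ∈ F := mem_of_mul_mem kuE huE pE
  have f01 : m 0 * m 1 ∈ F := half (by
    rw [show 2 * (m 0 * m 1) = uC m + vC m by simp only [uC, vC]; ring]; exact add_mem kuC kvC)
  have f23 : m 2 * m 3 ∈ F := half (by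
    rw [show 2 * (m 2 * m 3) = uC m - vC m by simp only [uC, vC]; ring]; exact sub_mem kuC kvC)
  have f02 : m 0 * m 2 ∈ F := half (by
    rw [show 2 * (m 0 * m 2) = uD m + vD m by simp only [uD, vD]; ring]; exact add_mem kuD kvD)
  have f13 : m 1 * m 3 ∈ F := half (by
    rw [show 2 * (m 1 * m 3) = uD m - vD m by simp only [uD, vD]; ring]; exact sub_mem kuD kvD)
  have f03 : m 0 * m 3 ∈ F := half (by
    rw [show 2 * (m 0 * m 3) = uE m + vE m by simp only [uE, vE]; ring]; exact add_mem kuE kvE)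
  have f12 : m 1 * m 2 ∈ F := half (by
    rw [show 2 * (m 1 * m 2) = uE m - vE m by simp only [uE, vE]; ring]; exact sub_mem kuE kvE)
  rw [sq] at f0 f1 f2 f3
  fin_cases i <;> fin_cases j <;> first | assumption | (rw [mul_comm]; assumption)

/-- After scaling by `c` to reach `sE = 1`, both `c ^ 2 * n i` and `c ^ 2` are products of two
coordinates, and their quotient is `n i`. -/
theorem coord_mem_sqrtField {p : Fin 5 → K} (hΔ : segre p ≠ 0) (hβ : beta p ≠ 0) [IsAlgClosed L]
    (hq : OffSingularHyperplanes (thirdPoint (coordsIn L p))) {n : Fin 4 → L}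
    (hn : IsSingularPoint (thirdPoint (coordsIn L p)) n) {k : Fin 4} (hk : n k = 1) (i : Fin 4) :
    n i ∈ sqrtField L p := by
  obtain ⟨c, hc⟩ := IsAlgClosed.exists_pow_nat_eq (1 / sE n) two_pos
  have on := hn.offFundamentalQuadrics hq
  have hc0 : c ≠ 0 := by
    rintro rfl
    exact one_div_ne_zero on.sE (by rw [← hc]; ring)
  have hm := hn.smul hc0
  obtain ⟨t, ht0, ht⟩ := hm.exists_eq_smul_kummer hq
  have h1 : sE (c • n) = 1 := by
    rw [show sE (c • n) = c ^ 2 * sE n by simp only [sE, Pi.smul_apply, smul_eq_mul]; ring, hc,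
      one_div_mul_cancel on.sE]
  have key := mul_mem_sqrtField hΔ hβ hq ht0 (hm.offFundamentalQuadrics hq) ht h1
  have hkk := key k k
  have hik := key k i
  simp only [Pi.smul_apply, smul_eq_mul, hk, mul_one] at hkk hik
  refine mem_of_mul_mem hkk (mul_ne_zero hc0 hc0) ?_
  rwa [mul_assoc]

theorem scalar_mem_sqrtField {p : Fin 5 → K} (hΔ : segre p ≠ 0) (hβ : beta p ≠ 0) [IsAlgClosed L]
    (hq : OffSingularHyperplanes (thirdPoint (coordsIn L p))) {n : Fin 4 → L} {t ρ : L}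
    (hn : IsSingularPoint (thirdPoint (coordsIn L p)) n)
    (ht : thirdPoint (coordsIn L p) = t • kummer n)
    (hρ : 4 * segre (coordsIn L p) * ρ ^ 2 = t) {k : Fin 4} (hk : n k = 1) :
    ρ ∈ sqrtField L p := by
  have on := hn.offFundamentalQuadrics hq
  have hΔL : segre (coordsIn L p) ≠ 0 := by
    rw [segre_coordsIn]; exact (map_ne_zero _).2 hΔ
  obtain ⟨-, -, hD, -, -, huD, -, huE, -⟩ :=
    fundamentalQuadrics_mem fun i => coord_mem_sqrtField hΔ hβ hq hn hk i
  have g1 : 2 * segre (coordsIn L p) * ρ * (sD n * uD n * uE n) ∈ sqrtField L p := by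
    rw [sqrtField_eq hβ ht (sq_root_eq hρ)]
    exact IntermediateField.subset_adjoin K _ (by simp)
  refine mem_of_mul_mem (mul_mem (mul_mem (ofNat_mem _ 2) (segre_mem _ p))
    (mul_mem (mul_mem hD huD) huE))
    (mul_ne_zero (mul_ne_zero two_ne_zero hΔL) (mul_ne_zero (mul_ne_zero on.sD on.uD) on.uE)) ?_
  convert g1 using 1
  ring

theorem isDefinedOver_sqrtField {p : Fin 5 → K} (hΔ : segre p ≠ 0) (hβ : beta p ≠ 0)
    [IsAlgClosed L] (hq : OffSingularHyperplanes (thirdPoint (coordsIn L p)))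
    {I : Ideal (MvPolynomial (Fin 4) L)} (hI : I ∈ associatedConics (coordsIn L p)) :
    IsDefinedOver (sqrtField L p) I := by
  have hΔL : segre (coordsIn L p) ≠ 0 := by
    rw [segre_coordsIn]; exact (map_ne_zero _).2 hΔ
  obtain ⟨n, t, ρ, hn, ht, hρ, rfl⟩ := (mem_associatedConics hΔL hq).1 hI
  obtain ⟨k, hk⟩ := Function.ne_iff.1 hn.1
  have hc : (n k)⁻¹ ≠ 0 := inv_ne_zero hk
  have hm := hn.smul hc
  have hmk : ((n k)⁻¹ • n) k = 1 := inv_mul_cancel₀ hk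
  have e : n = n k • ((n k)⁻¹ • n) := (smul_inv_smul₀ hk n).symm
  have hI : conicIdeal n ρ = conicIdeal ((n k)⁻¹ • n) (ρ * n k ^ 6) := by
    rw [← conicIdeal_smul hk, ← e]
  have ht' : thirdPoint (coordsIn L p) = (t * n k ^ 12) • kummer ((n k)⁻¹ • n) := by
    rw [mul_smul, ← kummer_smul, ← e, ht]
  rw [hI]
  exact isDefinedOver_conicIdeal (coord_mem_sqrtField hΔ hβ hq hm hmk)
    (scalar_mem_sqrtField hΔ hβ hq hm ht' (by rw [← hρ]; ring) hmk)

theorem sqrtField_le_of_isDefinedOver {p : Fin 5 → K} (hΔ : segre p ≠ 0) (hβ : beta p ≠ 0)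
    [IsAlgClosed L] [IsGalois K L] (hq : OffSingularHyperplanes (thirdPoint (coordsIn L p)))
    {F : IntermediateField K L}
    (hF : ∀ I ∈ associatedConics (coordsIn L p), IsDefinedOver F I) : sqrtField L p ≤ F := by
  have hΔL : segre (coordsIn L p) ≠ 0 := by
    rw [segre_coordsIn]; exact (map_ne_zero _).2 hΔ
  obtain ⟨n, hn⟩ := exists_singularPoint hq (segre_thirdPoint _)
  obtain ⟨k, hk⟩ := Function.ne_iff.1 hn.1
  replace hn := hn.smul (inv_ne_zero hk)
  have hk : ((n k)⁻¹ • n) k = 1 := inv_mul_cancel₀ hk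
  generalize (n k)⁻¹ • n = m at hn hk
  obtain ⟨t, -, ht⟩ := hn.exists_eq_smul_kummer hq
  obtain ⟨ρ, hρ⟩ := IsAlgClosed.exists_pow_nat_eq (t / (4 * segre (coordsIn L p))) two_pos
  have hρ' : 4 * segre (coordsIn L p) * ρ ^ 2 = t := by rw [hρ]; field_simp
  have hI := hF _ ((mem_associatedConics hΔL hq).2 ⟨m, t, ρ, hn, ht, hρ', rfl⟩)
  exact sqrtField_le hβ ht hρ' (hI.coord_mem hk) (hI.scalar_mem (hn.offFundamentalQuadrics hq) hk)

theorem eq_sqrtField_of_isK1 {p : Fin 5 → K} (hΔ : segre p ≠ 0) (hβ : beta p ≠ 0)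
    [IsAlgClosed L] (hq : OffSingularHyperplanes (thirdPoint (coordsIn L p)))
    {F : IntermediateField K L} (hF : IsK1 p F) : F = sqrtField L p := by
  have hΔL : segre (coordsIn L p) ≠ 0 := by
    rw [segre_coordsIn]; exact (map_ne_zero _).2 hΔ
  obtain ⟨r₁, r₂, r₃, a, b, h1, h2, h3, hn, ha, hb, hF⟩ := hF
  have on := hn.offFundamentalQuadrics hq
  obtain ⟨t, ht0, ht⟩ := hn.exists_eq_smul_kummer hq
  obtain ⟨ρ, hρ⟩ := IsAlgClosed.exists_pow_nat_eq (t / (4 * segre (coordsIn L p))) two_pos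
  have hρ' : 4 * segre (coordsIn L p) * ρ ^ 2 = t := by rw [hρ]; field_simp
  have hρ0 : ρ ≠ 0 := by
    rintro rfl
    exact ht0 (by rw [← hρ']; ring)
  have nP : uD ![r₃, r₂, r₁, 1] * vD ![r₃, r₂, r₁, 1] * (uE ![r₃, r₂, r₁, 1] * vE ![r₃, r₂, r₁, 1])
      ≠ 0 := mul_ne_zero (mul_ne_zero on.uD on.vD) (mul_ne_zero on.uE on.vE)
  have eP : uD ![r₃, r₂, r₁, 1] * vD ![r₃, r₂, r₁, 1] * (uE ![r₃, r₂, r₁, 1] * vE ![r₃, r₂, r₁, 1])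
      = (r₃ ^ 2 * r₁ ^ 2 - r₂ ^ 2) * (r₃ ^ 2 - r₂ ^ 2 * r₁ ^ 2) := by
    simp only [uD, vD, uE, vE, Matrix.cons_val]; ring
  have e0 : thirdPoint (coordsIn L p) 0 = t * kummer ![r₃, r₂, r₁, 1] 0 := by rw [ht]; rfl
  have e2 : thirdPoint (coordsIn L p) 2 = t * kummer ![r₃, r₂, r₁, 1] 2 := by rw [ht]; rfl
  have e1 : thirdPoint (coordsIn L p) 1 = t * kummer ![r₃, r₂, r₁, 1] 1 := by rw [ht]; rfl
  have n1 : thirdPoint (coordsIn L p) 1 ≠ 0 := by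
    rw [e1]
    simp only [kummer, Matrix.cons_val]
    exact mul_ne_zero ht0 (mul_ne_zero (mul_ne_zero two_ne_zero (by simp [h1, h2, h3]))
      (mul_ne_zero (mul_ne_zero (mul_ne_zero on.s0 on.sC) on.sD) on.sE))
  -- The two expressions in `A₁, C₁` are values of `X_{p₁}` at `(0, 0, 1, -r₁)` and `(r₂/r₃, -1, 0,
  -- 0)`. Both points lie on the plane dual to the node, where `X_{p₁}` is `-t/4` times the squared
  -- trope quadric.
  have ha2 : a ^ 2 = (2 * ρ * ((r₃ ^ 2 * r₁ ^ 2 - r₂ ^ 2) * (r₃ ^ 2 - r₂ ^ 2 * r₁ ^ 2))) ^ 2 := by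
    rw [e0, e2, ← hρ'] at ha
    simp only [kummer, uC, vC, uD, vD, uE, vE, Matrix.cons_val] at ha
    field_simp at ha
    linear_combination ha
  have hb2 : (b * r₃ ^ 2) ^ 2
      = (2 * ρ * ((r₃ ^ 2 * r₁ ^ 2 - r₂ ^ 2) * (r₃ ^ 2 - r₂ ^ 2 * r₁ ^ 2))) ^ 2 := by
    rw [e0, e2, ← hρ'] at hb
    simp only [kummer, uC, vC, uD, vD, uE, vE, Matrix.cons_val] at hb
    field_simp at hb
    linear_combination hb
  rw [eP] at nP
  generalize hPdef : (r₃ ^ 2 * r₁ ^ 2 - r₂ ^ 2) * (r₃ ^ 2 - r₂ ^ 2 * r₁ ^ 2) = P at ha2 hb2 nP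
  have hPmem {F : IntermediateField K L} (m1 : r₁ ∈ F) (m2 : r₂ ∈ F) (m3 : r₃ ∈ F) :
      2 * P ∈ F := by
    rw [← hPdef]
    exact mul_mem (ofNat_mem _ 2) (mul_mem
      (sub_mem (mul_mem (pow_mem m3 2) (pow_mem m1 2)) (pow_mem m2 2))
      (sub_mem (pow_mem m3 2) (mul_mem (pow_mem m2 2) (pow_mem m1 2))))
  have sign {F : IntermediateField K L} {x y : L} (h : x ^ 2 = y ^ 2) (hx : x ∈ F) : y ∈ F := by
    rcases sq_eq_sq_iff_eq_or_eq_neg.1 h with h | h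
    · exact h ▸ hx
    · rw [show y = -x by rw [h, neg_neg]]
      exact neg_mem hx
  apply le_antisymm
  · rw [hF, IntermediateField.adjoin_le_iff]
    have hM := coord_mem_sqrtField hΔ hβ hq hn (k := 3) rfl
    have m1 : r₁ ∈ sqrtField L p := hM 2
    have m2 : r₂ ∈ sqrtField L p := hM 1
    have m3 : r₃ ∈ sqrtField L p := hM 0
    have mρ := scalar_mem_sqrtField hΔ hβ hq hn ht hρ' (k := 3) rfl
    have mP : 2 * ρ * P ∈ sqrtField L p := by
      rw [mul_right_comm]
      exact mul_mem (hPmem m1 m2 m3) mρ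
    rintro x (rfl | rfl | rfl | rfl)
    · exact m1
    · exact m2
    · exact sign ha2.symm mP
    · refine mem_of_mul_mem (pow_mem m3 2) (pow_ne_zero 2 h3) ?_
      rw [mul_comm]
      exact sign hb2.symm mP
  · have m1 : r₁ ∈ F := hF ▸ IntermediateField.subset_adjoin K _ (by simp)
    have m2 : r₂ ∈ F := hF ▸ IntermediateField.subset_adjoin K _ (by simp)
    have ma : a ∈ F := hF ▸ IntermediateField.subset_adjoin K _ (by simp)
    have mb : b ∈ F := hF ▸ IntermediateField.subset_adjoin K _ (by simp)
    have hb0 : b ≠ 0 := by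
      rintro rfl
      have : 2 * ρ * P ≠ 0 := mul_ne_zero (mul_ne_zero two_ne_zero hρ0) nP
      apply pow_ne_zero 2 this
      rw [← hb2]
      ring
    -- `b * r₃ ^ 2 = ± a`: this is what the second root contributes to `K₁`.
    have m3' : r₃ ^ 2 ∈ F := mem_of_mul_mem mb hb0 (sign (ha2.trans hb2.symm) ma)
    -- With `r₃ ^ 2` known, the derivative in the last variable is a linear equation for `r₃` with
    -- leading coefficient `B₁ * r₁ * r₂ ≠ 0`.
    have m3 : r₃ ∈ F := by
      obtain ⟨-, -, -, -, -, e⟩ := (singularPoint_iff _ _).1 hn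
      simp only [Matrix.cons_val] at e
      have hqF := thirdPoint_mem F p
      refine mem_of_mul_mem (mul_mem (mul_mem (hqF 1) m1) m2)
        (mul_ne_zero (mul_ne_zero n1 h1) h2) ?_
      rw [show thirdPoint (coordsIn L p) 1 * r₁ * r₂ * r₃ =
        -(4 * thirdPoint (coordsIn L p) 0 + 2 * (thirdPoint (coordsIn L p) 2 * r₁ ^ 2
          + thirdPoint (coordsIn L p) 3 * r₂ ^ 2 + thirdPoint (coordsIn L p) 4 * r₃ ^ 2)) by
        linear_combination e]
      exact neg_mem (add_mem (mul_mem (ofNat_mem _ 4) (hqF 0)) (mul_mem (ofNat_mem _ 2)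
        (add_mem (add_mem (mul_mem (hqF 2) (pow_mem m1 2)) (mul_mem (hqF 3) (pow_mem m2 2)))
          (mul_mem (hqF 4) m3'))))
    refine sqrtField_le hβ ht hρ' (fun i => ?_) ?_
    · fin_cases i
      exacts [m3, m2, m1, one_mem F]
    · refine mem_of_mul_mem (hPmem m1 m2 m3) (mul_ne_zero two_ne_zero nP) ?_
      rw [mul_right_comm]
      exact sign ha2 ma

/-- `B₁ = β B` is nonzero, and it is divisible by the product of the coordinates of any node, so
none of them vanishes. -/
theorem exists_isK1 {p : Fin 5 → K} (hβ : beta p ≠ 0) (hB : p 1 ≠ 0)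
    [IsAlgClosed L] (hq : OffSingularHyperplanes (thirdPoint (coordsIn L p))) :
    ∃ F : IntermediateField K L, IsK1 p F := by
  obtain ⟨n, hn⟩ := exists_singularPoint hq (segre_thirdPoint _)
  obtain ⟨t, ht0, ht⟩ := hn.exists_eq_smul_kummer hq
  have n1 : thirdPoint (coordsIn L p) 1 ≠ 0 := by
    rw [thirdPoint_coordsIn]
    refine (map_ne_zero _).2 ?_
    simp [thirdPoint, node1, hβ, hB]
  have hprod : n 0 * n 1 * n 2 * n 3 ≠ 0 := by
    intro h
    apply n1
    rw [ht]
    simp [kummer, h]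
  have h3 := right_ne_zero_of_mul hprod
  have h2 := right_ne_zero_of_mul (left_ne_zero_of_mul hprod)
  have h1 := right_ne_zero_of_mul (left_ne_zero_of_mul (left_ne_zero_of_mul hprod))
  have h0 := left_ne_zero_of_mul (left_ne_zero_of_mul (left_ne_zero_of_mul hprod))
  have e : (n 3)⁻¹ • n = ![(n 3)⁻¹ * n 0, (n 3)⁻¹ * n 1, (n 3)⁻¹ * n 2, 1] := by
    ext i
    fin_cases i <;> simp [h3]
  have hm := hn.smul (inv_ne_zero h3)
  rw [e] at hm
  have root (x : L) : ∃ y : L, y ^ 2 + x = 0 := by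
    obtain ⟨y, hy⟩ := IsAlgClosed.exists_pow_nat_eq (-x) two_pos
    exact ⟨y, by rw [hy, neg_add_cancel]⟩
  obtain ⟨a, ha⟩ := root _
  obtain ⟨b, hb⟩ := root _
  have h3' := inv_ne_zero h3
  exact ⟨_, (n 3)⁻¹ * n 2, (n 3)⁻¹ * n 1, (n 3)⁻¹ * n 0, a, b, mul_ne_zero h3' h2,
    mul_ne_zero h3' h1, mul_ne_zero h3' h0, hm, ha, hb, rfl⟩

end SqrtField

end HeisenbergQuartic

/-! ### The theorem over the algebraic closure. -/

open HeisenbergQuartic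
theorem mainTheorem7 (K : Type*) [Field K] [NumberField K] (p : Fin 5 → K)
    (hΔ : segre p ≠ 0) (hp : OffSingularHyperplanes p) (hβ : beta p ≠ 0) :
    (associatedConics (coordsIn (AlgebraicClosure K) p)).ncard = 32 ∧
    (∀ I ∈ associatedConics (coordsIn (AlgebraicClosure K) p),
      quartic (coordsIn (AlgebraicClosure K) p) ∈ I) ∧
    IsLeast {F : IntermediateField K (AlgebraicClosure K) |
        ∀ I ∈ associatedConics (coordsIn (AlgebraicClosure K) p), IsDefinedOver F I}
      (sqrtField (AlgebraicClosure K) p) ∧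
    (p 1 ≠ 0 → ∃ F : IntermediateField K (AlgebraicClosure K), IsK1 p F) ∧
    ∀ F : IntermediateField K (AlgebraicClosure K), IsK1 p F →
      (∀ I ∈ associatedConics (coordsIn (AlgebraicClosure K) p), IsDefinedOver F I) ∧
      F = sqrtField (AlgebraicClosure K) p := by
  have : CharZero (AlgebraicClosure K) := charZero_of_injective_algebraMap
    (algebraMap K (AlgebraicClosure K)).injective
  have hΔL : segre (coordsIn (AlgebraicClosure K) p) ≠ 0 := by
    rw [segre_coordsIn]; exact (map_ne_zero _).2 hΔ
  have hβL : beta (coordsIn (AlgebraicClosure K) p) ≠ 0 := by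
    rw [beta_coordsIn]; exact (map_ne_zero _).2 hβ
  have hq := offSingularHyperplanes_thirdPoint
    (offSingularHyperplanes_coordsIn (L := AlgebraicClosure K) hp) hβL
  refine ⟨ncard_associatedConics hΔL hq, fun I hI => quartic_mem_of_mem_associatedConics hΔL hβL hI,
    ⟨fun I hI => isDefinedOver_sqrtField hΔ hβ hq hI,
      fun F hF => sqrtField_le_of_isDefinedOver hΔ hβ hq hF⟩,
    fun hB => exists_isK1 hβ hB hq, fun F hF => ?_⟩
  have e := eq_sqrtField_of_isK1 hΔ hβ hq hF
  exact ⟨fun I hI => e ▸ isDefinedOver_sqrtField hΔ hβ hq hI, e⟩
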